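/- Let $k$ be a field, $R=k[x_1,\dots,x_n]$ with its $\mathbb Z^n$-grading, $I\subseteq R$ a monomial ideal, and $$0\leftarrow I\leftarrow F_0\xleftarrow{d_1}F_1\leftarrow\cdots\leftarrow F_m\leftarrow 0$$ its minimal $\mathbb Z^n$-graded free resolution. Let $B\subset\mathbb Z^n$ be the Betti poset of $I$: the set of degrees of the elements of a multigraded basis of $\bigoplus_i F_i$, ordered componentwise. Write $\lambda\lessdot\alpha$ if $\alpha$ covers $\lambda$ in $B$. The ideal $I$ is called Betti-linear if the $F_i$ have multigraded bases $B_i$ such that for all $i\ge 1$ and $\tau\in B_i$, every $\gamma\in B_{i-1}$ occurring with non-zero coefficient in $d_i(\tau)$ satisfies $\operatorname{mdeg}\gamma\lessdot\operatorname{mdeg}\tau$. For $\alpha\in B$ let $\Delta_\alpha$ and $\Delta_{\le\alpha}$ be the order complexes of $B_{<\alpha}$ and $B_{\le\alpha}$, and set $\mathscr D_{i,\alpha}=\widetilde H_{i-1}(\Delta_\alpha;k)$ for $i\ge 0$. For $\lambda\lessdot\alpha$ let $\Delta_{\alpha,\lambda}=\Delta_{\le\lambda}\cap\bigcup_{\lambda\ne\beta\lessdot\alpha}\Delta_{\le\beta}$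 and, for $i\ge1$, let $\phi_i^{\alpha,\lambda}:\mathscr D_{i,\alpha}\to\mathscr D_{i-1,\lambda}$ be the composition of the Mayer–Vietoris connecting homomorphism $\widetilde H_{i-1}(\Delta_\alpha;k)\to\widetilde H_{i-2}(\Delta_{\alpha,\lambda};k)$ for $\Delta_\alpha=\Delta_{\le\lambda}\cup\bigcup_{\lambda\ne\beta\lessdot\alpha}\Delta_{\le\beta}$ (sending $[c'+c'']$, with $c'$ and $c''$ supported on the two parts, to $[\partial c']$) with the map $\widetilde H_{i-2}(\Delta_{\alpha,\lambda};k)\to\widetilde H_{i-2}(\Delta_\lambda;k)$ induced by the inclusion. The homogenized poset construction $\mathscr F(B)$ is the sequence of multigraded free modules $\mathscr F_i=\bigoplus_{\alpha\in B}\mathscr D_{i,\alpha}\otimes_k R(-\alpha)$ with the maps $\partial_i:\mathscr F_i\to\mathscr F_{i-1}$ ($i\ge 1$) given on the summand of $\alpha$ by $\sum_{\lambda\lessdot\alpha}\phi_i^{\alpha,\lambda}\otimes x^{\alpha-\lambda}$. **Theorem.** The ideal $I$ is Betti-linear if and only if $\mathscr F(B)$ is isomorphic to the minimal free resolution $(F_i,d_i)_{i\ge0}$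 of $I$, by isomorphisms of multigraded $R$-modules that commute with the differentials. In particular, if $I$ has a pure resolution (each $F_i$ is generated in a single total degree), then $\mathscr F(B)$ is isomorphic in this sense to the minimal free resolution of $I$. -/

import Mathlib

open scoped TensorProduct DirectSum

noncomputable section

namespace BettiLinear

universe u v

/-! ### Order complexes and their reduced simplicial homology

The simplices of the order complex `Δ(P)` with `m` vertices are the strictly increasing
sequences `x₀ < ⋯ < x_{m-1}` in `P`, that is, the order embeddings `Fin m ↪o P`.  The empty
simplex (`m = 0`) is included, so that the homology below is reduced homology. -/

section OrderComplex

variable {P : Type u} [PartialOrder P]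

/-- The `i`-th codimension one face of a simplex of `Δ(P)`: omit the `i`-th vertex. -/
def face {m : ℕ} (s : Fin (m + 1) ↪o P) (i : Fin (m + 1)) : Fin m ↪o P :=
  (Fin.succAboveOrderEmb i).trans s

/-- A simplicial subcomplex of the order complex `Δ(P)`. -/
structure Subcomplex (P : Type u) [PartialOrder P] where
  /-- `faces m` is the set of simplices with `m` vertices. -/
  faces : ∀ m : ℕ, Set (Fin m ↪o P)
  face_mem : ∀ {m : ℕ} {s : Fin (m + 1) ↪o P}, s ∈ faces (m + 1) → ∀ i, face s i ∈ faces m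

/-- The order complex `Δ(Q)` of a subset `Q ⊆ P`. -/
def orderComplex (Q : Set P) : Subcomplex P where
  faces _ := {s | ∀ i, s i ∈ Q}
  face_mem hs _ _ := hs _

/-- The union of the order complexes `Δ(P_{≤ β})`, `β ∈ S`. -/
def unionIic (S : Set P) : Subcomplex P where
  faces m := ⋃ β ∈ S, (orderComplex (Set.Iic β)).faces m
  face_mem {m s} hs i := by
    simp only [Set.mem_iUnion] at hs ⊢
    obtain ⟨β, hβ, h⟩ := hs
    exact ⟨β, hβ, (orderComplex (Set.Iic β)).face_mem h i⟩

/-- The intersection of two subcomplexes. -/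
def Subcomplex.inter (K L : Subcomplex P) : Subcomplex P where
  faces m := K.faces m ∩ L.faces m
  face_mem hs i := ⟨K.face_mem hs.1 i, L.face_mem hs.2 i⟩

variable (k : Type v) [Field k]

/-- The simplicial boundary map `C̃_m(Δ(P), k) → C̃_{m-1}(Δ(P), k)`, from combinations of
simplices with `m + 1` vertices to combinations of simplices with `m` vertices (for `m = 0` it is
the augmentation). -/
def boundary (m : ℕ) : ((Fin (m + 1) ↪o P) →₀ k) →ₗ[k] ((Fin m ↪o P) →₀ k) :=
  Finsupp.lsum k fun s => ∑ i : Fin (m + 1), (-1 : k) ^ (i : ℕ) • Finsupp.lsingle (face s i)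

theorem boundary_boundary (m : ℕ) (c : (Fin (m + 2) ↪o P) →₀ k) :
    boundary k m (boundary k (m + 1) c) = 0 := by
  suffices h : (boundary (P := P) k m).comp (boundary k (m + 1)) = 0 from LinearMap.congr_fun h c
  refine Finsupp.lhom_ext fun s a => ?_
  simp only [boundary, LinearMap.comp_apply, Finsupp.lsum_single, LinearMap.sum_apply,
    LinearMap.smul_apply, map_sum, map_smul, Finsupp.lsingle_apply, LinearMap.zero_apply,
    Finset.smul_sum, smul_smul]
  rw [← Finset.sum_product']
  refine Finset.sum_involution
    (fun p _ => ((p.1.succAbove p.2, p.2.predAbove p.1) : Fin (m + 2) × Fin (m + 1))) ?_ ?_ ?_ ?_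
  · rintro ⟨i, j⟩ -
    have hf : face (face s (i.succAbove j)) (j.predAbove i) = face (face s i) j := by
      ext l
      simp [face, Fin.succAbove_succAbove_succAbove_predAbove]
    have hs : (-1 : k) ^ ((i.succAbove j : ℕ)) * (-1) ^ ((j.predAbove i : ℕ))
        = - ((-1) ^ (i : ℕ) * (-1) ^ (j : ℕ)) := by
      rw [← pow_add, Fin.neg_one_pow_succAbove_add_predAbove, pow_add]
    simp only [hf, hs, neg_smul, add_neg_cancel]
  · rintro ⟨i, j⟩ - - h
    exact Fin.succAbove_ne i j (congrArg Prod.fst h)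
  · intros; simp
  · rintro ⟨i, j⟩ -
    simp [Fin.succAbove_succAbove_predAbove, Fin.predAbove_predAbove_succAbove]

/-- The reduced simplicial chains `C̃_{m-1}(K, k)` of a subcomplex `K ⊆ Δ(P)`. -/
def chains (K : Subcomplex P) (m : ℕ) : Submodule k ((Fin m ↪o P) →₀ k) :=
  Finsupp.supported k k (K.faces m)

/-- The cycles `Z̃_{m-1}(K, k)`. -/
def cycles (K : Subcomplex P) : ∀ m : ℕ, Submodule k ((Fin m ↪o P) →₀ k)
  | 0 => chains k K 0
  | m + 1 => chains k K (m + 1) ⊓ LinearMap.ker (boundary k m)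

/-- The boundaries `B̃_{m-1}(K, k)`. -/
def boundaries (K : Subcomplex P) (m : ℕ) : Submodule k ((Fin m ↪o P) →₀ k) :=
  (chains k K (m + 1)).map (boundary k m)

/-- The quotient `Z / (Z ∩ B)` of two subspaces of a vector space. -/
abbrev Subquotient {k : Type v} [Field k] {V : Type u} [AddCommGroup V] [Module k V]
    (Z B : Submodule k V) : Type u :=
  Z ⧸ B.submoduleOf Z

/-- The reduced homology `H̃_{m-1}(K, k)`; note the index shift. -/
abbrev redHomology (K : Subcomplex P) (m : ℕ) : Type (max u v) :=
  Subquotient (cycles k K m) (boundaries k K m)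

theorem chains_mono {K L : Subcomplex P} {m : ℕ} (h : K.faces m ⊆ L.faces m) :
    chains k K m ≤ chains k L m :=
  Finsupp.supported_mono h

theorem cycles_mono {K L : Subcomplex P} (h : ∀ m, K.faces m ⊆ L.faces m) (m : ℕ) :
    cycles k K m ≤ cycles k L m := by
  cases m with
  | zero => exact chains_mono k (h 0)
  | succ m => exact inf_le_inf_right _ (chains_mono k (h _))

theorem boundary_mem_chains {K : Subcomplex P} {m : ℕ} {c : (Fin (m + 1) ↪o P) →₀ k}
    (hc : c ∈ chains k K (m + 1)) : boundary k m c ∈ chains k K m := by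
  rw [boundary, Finsupp.lsum_apply, Finsupp.sum]
  refine Submodule.sum_mem _ fun s hs => ?_
  rw [LinearMap.sum_apply]
  refine Submodule.sum_mem _ fun i _ => ?_
  rw [LinearMap.smul_apply]
  exact Submodule.smul_mem _ _ (Finsupp.single_mem_supported k _
    (K.face_mem ((Finsupp.mem_supported k c).1 hc hs) i))

theorem mem_cycles {K : Subcomplex P} {m : ℕ} {c : (Fin m ↪o P) →₀ k}
    (hc : c ∈ chains k K m) (h : ∃ e, boundary k m e = c) : c ∈ cycles k K m := by
  cases m with
  | zero => exact hc
  | succ m =>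
    obtain ⟨e, rfl⟩ := h
    exact ⟨hc, boundary_boundary k m e⟩

/-- The map `H̃_{m-1}(K, k) → H̃_{m-1}(L, k)` induced by an inclusion `K ⊆ L`. -/
def homologyIncl {K L : Subcomplex P} (h : ∀ m, K.faces m ⊆ L.faces m) (m : ℕ) :
    redHomology k K m →ₗ[k] redHomology k L m :=
  Submodule.mapQ _ _ (Submodule.inclusion (cycles_mono k h m)) fun _ hx =>
    Submodule.map_mono (chains_mono k (h (m + 1))) hx

open scoped Classical in
/-- The part `c'` of a chain `c` that is supported by `K`. -/
def restrict (K : Subcomplex P) (m : ℕ) : ((Fin m ↪o P) →₀ k) →ₗ[k] ((Fin m ↪o P) →₀ k) :=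
  (chains k K m).subtype.comp (Finsupp.restrictDom k k (K.faces m))

theorem restrict_mem (K : Subcomplex P) (m : ℕ) (c : (Fin m ↪o P) →₀ k) :
    restrict k K m c ∈ chains k K m :=
  Subtype.property _

open scoped Classical in
theorem restrict_apply (K : Subcomplex P) (m : ℕ) (c : (Fin m ↪o P) →₀ k) (s : Fin m ↪o P) :
    restrict k K m c s = if s ∈ K.faces m then c s else 0 :=
  Finsupp.filter_apply _ _ _

theorem sub_restrict_mem {K L M : Subcomplex P}
    (h : ∀ m, M.faces m = K.faces m ∪ L.faces m) {m : ℕ} {c : (Fin m ↪o P) →₀ k}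
    (hc : c ∈ chains k M m) : c - restrict k K m c ∈ chains k L m := by
  classical
  refine (Finsupp.mem_supported k _).2 fun s hs => ?_
  have hs' : c s - restrict k K m c s ≠ 0 := by simpa using hs
  by_cases hK : s ∈ K.faces m
  · refine absurd ?_ hs'
    rw [restrict_apply, if_pos hK, sub_self]
  · have h0 : restrict k K m c s = 0 := by
      rw [restrict_apply, if_neg hK]
    have hcs : s ∈ c.support := by simpa [h0] using hs'
    have := (Finsupp.mem_supported k c).1 hc hcs
    rw [h m] at this
    exact this.resolve_left hK

theorem boundary_restrict_mem {K L M : Subcomplex P}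
    (h : ∀ m, M.faces m = K.faces m ∪ L.faces m) {m : ℕ} {c : (Fin (m + 1) ↪o P) →₀ k}
    (hc : c ∈ cycles k M (m + 1)) :
    boundary k m (restrict k K (m + 1) c) ∈ cycles k (K.inter L) m := by
  refine mem_cycles k ?_ ⟨_, rfl⟩
  rw [chains, Subcomplex.inter, Finsupp.supported_inter]
  refine ⟨boundary_mem_chains k (restrict_mem k K _ c), ?_⟩
  have h2 := boundary_mem_chains k (sub_restrict_mem k h hc.1)
  rw [map_sub, LinearMap.mem_ker.1 hc.2, zero_sub] at h2
  exact (Submodule.neg_mem_iff _).1 h2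

/-- The connecting homomorphism `H̃_m(M, k) → H̃_{m-1}(K ∩ L, k)` of the Mayer–Vietoris sequence
in reduced homology of a triple `(K, L, M)` of simplicial complexes with `M = K ∪ L`.  It sends
the class of a cycle `c = c' + c''`, with `c'` supported by `K` and `c''` supported by `L`, to the
class of the boundary of `c'`; here `c'` consists of all terms of `c` that lie in `K`. -/
def connecting {K L M : Subcomplex P} (h : ∀ m, M.faces m = K.faces m ∪ L.faces m) (m : ℕ) :
    redHomology k M (m + 1) →ₗ[k] redHomology k (K.inter L) m :=
  Submodule.mapQ _ _
    ((((boundary k m).comp (restrict k K (m + 1))).comp (cycles k M (m + 1)).subtype).codRestrict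
      (cycles k (K.inter L) m) fun c => boundary_restrict_mem k h c.2)
    (by
      rintro ⟨c, hc⟩ hx
      obtain ⟨e, he, rfl⟩ : c ∈ boundaries k M (m + 1) := hx
      refine ⟨restrict k K (m + 1) (boundary k (m + 1) e)
        - boundary k (m + 1) (restrict k K (m + 2) e), ?_, ?_⟩
      · rw [chains, Subcomplex.inter, Finsupp.supported_inter]
        refine ⟨Submodule.sub_mem _ (restrict_mem k K _ _)
          (boundary_mem_chains k (restrict_mem k K _ _)), ?_⟩
        have h1 := boundary_mem_chains k (sub_restrict_mem k h he)
        have h2 := sub_restrict_mem k h (boundary_mem_chains k he)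
        rw [map_sub] at h1
        have h3 := Submodule.sub_mem _ h1 h2
        rwa [sub_sub_sub_cancel_left] at h3
      · rw [map_sub, boundary_boundary, sub_zero]
        rfl)

end OrderComplex

/-! ### The poset construction -/

section PosetConstruction

variable (k : Type v) [Field k] {P : Type u} [PartialOrder P]

/-- `Δ_α = Δ(P_{<α})`. -/
def deltaLT (α : P) : Subcomplex P := orderComplex (Set.Iio α)

/-- `Δ_{≤α} = Δ(P_{≤α})`. -/
def deltaLE (α : P) : Subcomplex P := orderComplex (Set.Iic α)

/-- The union of the `Δ_{≤β}` over the elements `β ≠ l` that are covered by `α`. -/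
def deltaOther (α l : P) : Subcomplex P := unionIic {β | l ≠ β ∧ β ⋖ α}

/-- `Δ_{α,l}`, the intersection of `Δ_{≤l}` with the union of the other `Δ_{≤β}`, `β ⋖ α`. -/
def deltaInter (α l : P) : Subcomplex P := (deltaLE l).inter (deltaOther α l)

theorem deltaLT_eq_union [Finite P] {α l : P} (h : l ⋖ α) (m : ℕ) :
    (deltaLT α).faces m = (deltaLE l).faces m ∪ (deltaOther α l).faces m := by
  ext s
  constructor
  · intro hs
    cases m with
    | zero => exact Or.inl fun i => i.elim0
    | succ m =>
      obtain ⟨β, hβ, hβα⟩ := exists_le_covBy_of_lt (hs (Fin.last m))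
      have hall : ∀ i, s i ≤ β := fun i => (s.monotone (Fin.le_last i)).trans hβ
      by_cases hl : l = β
      · exact Or.inl (hl ▸ hall)
      · exact Or.inr (Set.mem_biUnion (⟨hl, hβα⟩ : l ≠ β ∧ β ⋖ α) hall)
  · rintro (hs | hs) i
    · exact (hs i).trans_lt h.lt
    · obtain ⟨β, hβ, hs⟩ := Set.mem_iUnion₂.1 hs
      exact (hs i).trans_lt hβ.2.lt

theorem deltaInter_subset {α l : P} (h : l ⋖ α) (m : ℕ) :
    (deltaInter α l).faces m ⊆ (deltaLT l).faces m := by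
  rintro s ⟨hs, hs'⟩ i
  obtain ⟨β, hβ, hs'⟩ := Set.mem_iUnion₂.1 hs'
  refine lt_of_le_of_ne (hs i) fun hi => ?_
  have hle : l ≤ β := hi ▸ hs' i
  exact h.2 (lt_of_le_of_ne hle hβ.1) hβ.2.lt

/-- `𝒟_{i,α} = H̃_{i-1}(Δ_α, k)`. -/
abbrev posetSummand (i : ℕ) (α : P) : Type (max u v) := redHomology k (deltaLT α) i

/-- The component `φ_{i+1}^{α,l} : 𝒟_{i+1,α} → 𝒟_{i,l}`, for `l ⋖ α`, of the differential of the
poset construction: the Mayer–Vietoris connecting homomorphism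
`H̃_i(Δ_α) → H̃_{i-1}(Δ_{α,l})` of the triple `(Δ_{≤l}, ⋃_{l ≠ β ⋖ α} Δ_{≤β}, Δ_α)`, followed by
the map to `H̃_{i-1}(Δ_l)` induced by the inclusion. -/
def posetMap [Finite P] (i : ℕ) {α l : P} (h : l ⋖ α) :
    posetSummand k (i + 1) α →ₗ[k] posetSummand k i l :=
  (homologyIncl k (deltaInter_subset h) i).comp (connecting k (deltaLT_eq_union h) i)

variable {n : ℕ} (η : P →o (Fin n → ℤ))

variable (P) in
/-- The module `𝓕_i(η) = ⨁_l 𝒟_{i,l} ⊗ R(-η(l))`, where `R = k[x_1, …, x_n]` (the factors of the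
tensor products are written in the other order). -/
abbrev posetModule (n i : ℕ) : Type (max u v) :=
  ⨁ l : P, MvPolynomial (Fin n) k ⊗[k] posetSummand k i l

/-- The exponent vector in `ℤⁿ` of a monomial. -/
def expZ {n : ℕ} (a : Fin n →₀ ℕ) : Fin n → ℤ := fun j => (a j : ℤ)

open scoped Classical in
/-- The component of degree `γ ∈ ℤⁿ` of `𝓕_i(η)`, generated by the elements `x^a ⊗ v` with
`v ∈ 𝒟_{i,l}` and `a + η(l) = γ`. -/
def posetGraded (i : ℕ) (γ : Fin n → ℤ) : AddSubgroup (posetModule k P n i) :=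
  AddSubgroup.closure {x | ∃ (l : P) (a : Fin n →₀ ℕ) (v : posetSummand k i l),
    expZ a + η l = γ ∧
    x = DirectSum.of (fun l : P => MvPolynomial (Fin n) k ⊗[k] posetSummand k i l) l
      (MvPolynomial.monomial a 1 ⊗ₜ[k] v)}

/-- The monomial `x^{γ-δ}`, for `δ ≤ γ` in `ℤⁿ`. -/
def monomialSub (γ δ : Fin n → ℤ) : MvPolynomial (Fin n) k :=
  MvPolynomial.monomial (Finsupp.equivFunOnFinite.symm fun j => (γ j - δ j).toNat) 1

open scoped Classical in
/-- The differential `∂_{i+1} : 𝓕_{i+1}(η) → 𝓕_i(η)`, given on the summand of `α` by the sum over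
`l ⋖ α` of the maps `x^{η(α)-η(l)} ⊗ φ_{i+1}^{α,l}`. -/
def posetDifferential [Finite P] (i : ℕ) :
    posetModule k P n (i + 1) →ₗ[MvPolynomial (Fin n) k] posetModule k P n i :=
  DirectSum.toModule (MvPolynomial (Fin n) k) P _ fun α =>
    ∑ᶠ l : {l : P // l ⋖ α},
      (DirectSum.lof (MvPolynomial (Fin n) k) P
        (fun l : P => MvPolynomial (Fin n) k ⊗[k] posetSummand k i l) l.1).comp
      (monomialSub k (η α) (η l.1) •
        (posetMap k i l.2).baseChange (MvPolynomial (Fin n) k))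

end PosetConstruction

/-! ### Multigraded minimal free resolutions of monomial ideals -/

section Resolutions

variable {k : Type v} [Field k] {n : ℕ}

/-- An ideal of `k[x_1, …, x_n]` is monomial if it is generated by monomials. -/
def IsMonomialIdeal (I : Ideal (MvPolynomial (Fin n) k)) : Prop :=
  ∃ S : Set (Fin n →₀ ℕ), I = Ideal.span ((fun a => MvPolynomial.monomial a (1 : k)) '' S)

/-- Let `M` be the free module with basis `b`, multigraded so that `b t` has degree `deg t`;
that is, `M = ⨁_t R(-deg t)`.  The element `x` is homogeneous of degree `γ ∈ ℤⁿ` (or zero). -/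
def IsHomogeneousOf {M : Type u} [AddCommGroup M] [Module (MvPolynomial (Fin n) k) M] {ι : Type}
    (b : Module.Basis ι (MvPolynomial (Fin n) k) M) (deg : ι → Fin n → ℤ) (x : M)
    (γ : Fin n → ℤ) : Prop :=
  ∀ t, ∀ a ∈ (b.repr x t).support, expZ a + deg t = γ

/-- A minimal multigraded free resolution
`0 ← I ← F_0 ← F_1 ← ⋯ ← F_m ← 0` of an ideal `I` of `R = k[x_1, …, x_n]`. -/
structure MinimalResolution (I : Ideal (MvPolynomial (Fin n) k)) where
  /-- The module `F_i`. -/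
  F : ℕ → Type u
  [addCommGroup : ∀ i, AddCommGroup (F i)]
  [module : ∀ i, Module (MvPolynomial (Fin n) k) (F i)]
  /-- The rank of `F_i`. -/
  rank : ℕ → ℕ
  /-- A basis of `F_i`, and the degrees of its elements; they determine the grading of `F_i`. -/
  basis : ∀ i, Module.Basis (Fin (rank i)) (MvPolynomial (Fin n) k) (F i)
  mdeg : ∀ i, Fin (rank i) → Fin n → ℤ
  /-- The differential `F_{i+1} → F_i`. -/
  d : ∀ i, F (i + 1) →ₗ[MvPolynomial (Fin n) k] F i
  /-- The augmentation `F_0 → R`, with image `I`. -/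
  aug : F 0 →ₗ[MvPolynomial (Fin n) k] MvPolynomial (Fin n) k
  finite_length : ∃ m, ∀ i, m < i → rank i = 0
  d_homogeneous : ∀ i t,
    IsHomogeneousOf (basis i) (mdeg i) (d i (basis (i + 1) t)) (mdeg (i + 1) t)
  aug_homogeneous : ∀ t, ∀ a ∈ (aug (basis 0 t)).support, expZ a = mdeg 0 t
  range_aug : LinearMap.range aug = I
  exact_zero : Function.Exact (d 0) aug
  exact_succ : ∀ i, Function.Exact (d (i + 1)) (d i)
  /-- Minimality: the image of `F_{i+1}` lies in `(x_1, …, x_n) F_i`. -/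
  minimal : ∀ i, LinearMap.range (d i) ≤
    Ideal.span (Set.range (MvPolynomial.X : Fin n → MvPolynomial (Fin n) k)) •
      (⊤ : Submodule (MvPolynomial (Fin n) k) (F i))

attribute [instance] MinimalResolution.addCommGroup MinimalResolution.module

namespace MinimalResolution

variable {I : Ideal (MvPolynomial (Fin n) k)} (F : MinimalResolution.{u} I)

/-- The Betti poset: the set of degrees of the basis elements of the minimal free resolution,
ordered as a subset of `ℤⁿ` (that is, by divisibility of the monomials). -/
def bettiPoset : Set (Fin n → ℤ) := {γ | ∃ i t, F.mdeg i t = γ}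

instance : Finite F.bettiPoset := by
  obtain ⟨m, hm⟩ := F.finite_length
  have h : F.bettiPoset ⊆ ⋃ i ∈ Set.Iic m, Set.range (F.mdeg i) := by
    rintro γ ⟨i, t, rfl⟩
    by_cases hi : m < i
    · exact absurd t.2 (by simp [hm i hi])
    · exact Set.mem_biUnion (not_lt.1 hi) ⟨t, rfl⟩
  exact ((Set.finite_Iic m).biUnion fun i _ => Set.finite_range _).subset h

/-- The inclusion of the Betti poset in `ℤⁿ`. -/
def bettiIncl : F.bettiPoset →o (Fin n → ℤ) := OrderHom.Subtype.val _

/-- Betti-linearity: there are multigraded bases `b_i` of the `F_i` such that, for every `t ∈ b_{i+1}`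
and `g ∈ b_i`, if `g` occurs in the expansion of the differential of `t`, then the degree of `g`
is covered by the degree of `t` in the Betti poset.  (A basis of `F_i` has `rank i` elements, and
the degree of an element of a multigraded basis lies in the Betti poset.) -/
def IsBettiLinear : Prop :=
  ∃ (b : ∀ i, Module.Basis (Fin (F.rank i)) (MvPolynomial (Fin n) k) (F.F i))
    (deg : ∀ i, Fin (F.rank i) → F.bettiPoset),
    (∀ i t, IsHomogeneousOf (F.basis i) (F.mdeg i) (b i t) (deg i t)) ∧
    ∀ i (t : Fin (F.rank (i + 1))) (g : Fin (F.rank i)),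
      (b i).repr (F.d i (b (i + 1) t)) g ≠ 0 → deg i g ⋖ deg (i + 1) t

/-- The resolution is pure: every `F_i` is generated in a single total degree. -/
def IsPure : Prop :=
  ∀ i, ∃ δ : ℤ, ∀ t, ∑ j, F.mdeg i t j = δ

/-- The poset construction on the Betti poset, homogenized, is isomorphic to the minimal free
resolution as a complex of multigraded modules. -/
def IsRecovered : Prop :=
  ∃ e : ∀ i, F.F i ≃ₗ[MvPolynomial (Fin n) k] posetModule k F.bettiPoset n i,
    (∀ i x γ, IsHomogeneousOf (F.basis i) (F.mdeg i) x γ ↔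
      e i x ∈ posetGraded k F.bettiIncl i γ) ∧
    ∀ i x, e i (F.d i x) = posetDifferential k F.bettiIncl i (e (i + 1) x)

end MinimalResolution

end Resolutions

end BettiLinear

end

noncomputable section

namespace BettiLinear

universe u v w

/-! ### Cones in order complexes -/

/-! Setting all variables to one in the resolution, augmented by R, gives a complex C of vector
spaces (`strand`) with a basis graded by B. For every p in B its part in degrees ≤ p is exact,
because some generator of I has degree ≤ p; by minimality the differential strictly lowers degrees.
Hence the homology of the part in degrees < p is the span of the basis elements of degree p, through
v ↦ [d v].

Coning recursively, t ↦ ± the cone with apex deg t over the image of d t, gives a chain map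
`toChains` from C to the chains of Δ(B). It is a quasi-isomorphism over every lower set
(`IsAcyclic.isQuasiIso`), by removing maximal elements one at a time. So the basis elements of
degree p index a basis of the homology of Δ_p (`degreeBasis`), with no linearity assumed.

If d v only involves degrees covered by that of v, write d v = w + c with w of degree l and c in the
other covered degrees. Simplices ending at another covered element are not in Δ_{≤l}, so the
connecting homomorphism keeps exactly the image of w, and the class of v goes to that of w
(`posetMap_degreeMap`). The matrices of C and of the maps φ therefore agree, and homogeneity
restores the monomials (`exists_equiv_posetModule`).

Conversely, the poset differential involves only covers by construction, so bases of the homology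
groups, carried through the isomorphism, witness linearity. In a pure resolution total degree
increases with homological position, which leaves no Betti degree strictly between two degrees
joined by the differential. -/

theorem eq_of_mem_supported {k : Type v} [Field k] {ι : Type w} {N : Type u} [AddCommGroup N]
    [Module k N] {A : Set ι} {f g : (ι →₀ k) →ₗ[k] N}
    (h : ∀ s ∈ A, f (Finsupp.single s 1) = g (Finsupp.single s 1)) {c : ι →₀ k}
    (hc : c ∈ Finsupp.supported k k A) : f c = g c := by
  rw [Finsupp.supported_eq_span_single] at hc
  refine LinearMap.eqOn_span ?_ hc
  rintro _ ⟨s, hs, rfl⟩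
  exact h s hs

theorem map_mem_of_mem_supported {k : Type v} [Field k] {ι : Type w} {N : Type u}
    [AddCommGroup N] [Module k N] {A : Set ι} {f : (ι →₀ k) →ₗ[k] N} {N' : Submodule k N}
    (h : ∀ s ∈ A, f (Finsupp.single s 1) ∈ N') {c : ι →₀ k}
    (hc : c ∈ Finsupp.supported k k A) : f c ∈ N' := by
  rw [Finsupp.supported_eq_span_single] at hc
  refine (Submodule.span_le (p := N'.comap f)).2 ?_ hc
  rintro _ ⟨s, hs, rfl⟩
  exact h s hs

section Cone

variable {P : Type u} [PartialOrder P]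

/-- Append a new largest vertex to a simplex. -/
def snocEmb {m : ℕ} (s : Fin m ↪o P) (p : P) (hs : ∀ i, s i < p) : Fin (m + 1) ↪o P :=
  OrderEmbedding.ofStrictMono (Fin.snoc (α := fun _ => P) s p) (by
    intro i j
    induction j using Fin.lastCases with
    | last =>
      induction i using Fin.lastCases with
      | last => intro h; exact absurd h (lt_irrefl _)
      | cast i => intro _; simpa using hs i
    | cast j =>
      induction i using Fin.lastCases with
      | last => intro h; exact absurd h (not_lt.2 (Fin.le_last _))
      | cast i => intro h; simpa using h)

@[simp] theorem snocEmb_last {m : ℕ} (s : Fin m ↪o P) (p : P) (hs : ∀ i, s i < p) :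
    snocEmb s p hs (Fin.last m) = p :=
  Fin.snoc_last (α := fun _ => P) _ _

@[simp] theorem snocEmb_castSucc {m : ℕ} (s : Fin m ↪o P) (p : P) (hs : ∀ i, s i < p)
    (i : Fin m) : snocEmb s p hs i.castSucc = s i :=
  Fin.snoc_castSucc (α := fun _ => P) _ _ _

theorem face_apply {m : ℕ} (s : Fin (m + 1) ↪o P) (i : Fin (m + 1)) (j : Fin m) :
    face s i j = s (i.succAbove j) :=
  rfl

theorem face_last_apply {m : ℕ} (s : Fin (m + 1) ↪o P) (i : Fin m) :
    face s (Fin.last m) i = s i.castSucc := by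
  simp [face]

@[simp] theorem face_last_snocEmb {m : ℕ} (s : Fin m ↪o P) (p : P) (hs : ∀ i, s i < p) :
    face (snocEmb s p hs) (Fin.last m) = s := by
  ext i
  rw [face_last_apply, snocEmb_castSucc]

theorem snocEmb_face_last {m : ℕ} (s : Fin (m + 1) ↪o P)
    (h : ∀ i, face s (Fin.last m) i < s (Fin.last m)) :
    snocEmb (face s (Fin.last m)) (s (Fin.last m)) h = s := by
  ext i
  induction i using Fin.lastCases with
  | last => simp
  | cast i => rw [snocEmb_castSucc, face_last_apply]

theorem face_last_lt {m : ℕ} (s : Fin (m + 1) ↪o P) (i : Fin m) :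
    face s (Fin.last m) i < s (Fin.last m) := by
  rw [face_last_apply]
  exact s.strictMono (Fin.castSucc_lt_last i)

theorem face_snocEmb_castSucc {m : ℕ} (s : Fin (m + 1) ↪o P) (p : P) (hs : ∀ i, s i < p)
    (i : Fin (m + 1)) (hs' : ∀ j, face s i j < p) :
    face (snocEmb s p hs) i.castSucc = snocEmb (face s i) p hs' := by
  ext j
  induction j using Fin.lastCases with
  | last =>
    rw [snocEmb_last]
    rw [face_apply, Fin.succAbove_ne_last_last (Fin.castSucc_lt_last i).ne, snocEmb_last]
  | cast j =>
    rw [snocEmb_castSucc]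
    rw [face_apply, face_apply, Fin.castSucc_succAbove_castSucc, snocEmb_castSucc]

variable (k : Type v) [Field k]

open scoped Classical in
/-- The cone with apex `p` over a chain of `Δ(P_{<p})`. -/
def cone (p : P) (m : ℕ) : ((Fin m ↪o P) →₀ k) →ₗ[k] ((Fin (m + 1) ↪o P) →₀ k) :=
  Finsupp.lsum k fun s => if h : ∀ i, s i < p then Finsupp.lsingle (snocEmb s p h) else 0

open scoped Classical in
/-- The link of the vertex `p` in a chain all of whose simplices containing `p` have it as their
last vertex. -/
def link (p : P) (m : ℕ) : ((Fin (m + 1) ↪o P) →₀ k) →ₗ[k] ((Fin m ↪o P) →₀ k) :=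
  Finsupp.lsum k fun s => if s (Fin.last m) = p then Finsupp.lsingle (face s (Fin.last m)) else 0

theorem boundary_single {m : ℕ} (s : Fin (m + 1) ↪o P) :
    boundary k m (Finsupp.single s 1)
      = ∑ i : Fin (m + 1), (-1 : k) ^ (i : ℕ) • Finsupp.single (face s i) 1 := by
  simp [boundary]

theorem cone_single {m : ℕ} {s : Fin m ↪o P} {p : P} (h : ∀ i, s i < p) :
    cone k p m (Finsupp.single s 1) = Finsupp.single (snocEmb s p h) 1 := by
  simp [cone, h]

variable {k}

/-- With `link_eq_zero`, this reads off the part of a chain at the vertex p: `link` undoes the cone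
and kills chains that avoid p. -/
theorem link_cone {p : P} {m : ℕ} {c : (Fin m ↪o P) →₀ k}
    (hc : c ∈ chains k (orderComplex (Set.Iio p)) m) : link k p m (cone k p m c) = c := by
  refine eq_of_mem_supported (f := (link k p m).comp (cone k p m)) (g := LinearMap.id) ?_ hc
  intro s hs
  have hs' : ∀ i, s i < p := hs
  rw [LinearMap.comp_apply, cone_single k hs']
  simp only [link, Finsupp.lsum_single, snocEmb_last, if_true, face_last_snocEmb,
    Finsupp.lsingle_apply, LinearMap.id_apply]

theorem link_eq_zero {p : P} {Q : Set P} (hp : p ∉ Q) {m : ℕ} {c : (Fin (m + 1) ↪o P) →₀ k}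
    (hc : c ∈ chains k (orderComplex Q) (m + 1)) : link k p m c = 0 := by
  refine eq_of_mem_supported (g := 0) ?_ hc
  intro s hs
  have : s (Fin.last m) ≠ p := fun h => hp (h ▸ hs _)
  simp [link, this]

/-- The simplices of a cone with apex `p` have last vertex `p`. -/
theorem cone_mem_supported {p : P} {m : ℕ} (c : (Fin m ↪o P) →₀ k) :
    cone k p m c ∈ Finsupp.supported k k {s : Fin (m + 1) ↪o P | s (Fin.last m) = p} := by
  refine map_mem_of_mem_supported (A := Set.univ) ?_ (by simp)
  intro s _
  by_cases h : ∀ i, s i < p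
  · rw [cone_single k h]
    exact Finsupp.single_mem_supported k _ (snocEmb_last s p h)
  · simp only [cone, Finsupp.lsum_single, dif_neg h, LinearMap.zero_apply]
    exact Submodule.zero_mem _

theorem orderComplex_mono {Q Q' : Set P} (h : Q ⊆ Q') (m : ℕ) :
    (orderComplex Q).faces m ⊆ (orderComplex Q').faces m :=
  fun _ hs i => h (hs i)

/-- No condition on `c` is needed, since `cone` kills every simplex not lying below p. -/
theorem cone_mem {p : P} {S : Set P} (hS : Set.Iic p ⊆ S) {m : ℕ} (c : (Fin m ↪o P) →₀ k) :
    cone k p m c ∈ chains k (orderComplex S) (m + 1) :=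
  Finsupp.supported_mono (s := {s : Fin (m + 1) ↪o P | s (Fin.last m) = p})
    (fun s (hs : s (Fin.last m) = p) i =>
      hS (hs ▸ s.monotone (Fin.le_last i) : s i ≤ p)) (cone_mem_supported c)

theorem boundary_cone_zero {p : P} {c : (Fin 0 ↪o P) →₀ k} :
    boundary k 0 (cone k p 0 c) = c := by
  refine eq_of_mem_supported (f := (boundary k 0).comp (cone k p 0)) (g := LinearMap.id)
    (A := Set.univ) ?_ (by simp)
  intro s _
  rw [LinearMap.comp_apply, cone_single k (fun i => i.elim0), boundary_single]
  have h : ∀ t : Fin 0 ↪o P, t = s := fun t => by ext i; exact i.elim0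
  rw [Fin.sum_univ_one, h (face _ _)]
  simp

/-- The apex is the last vertex: omitting another vertex gives a cone over a face with unchanged
sign, and omitting the apex gives back the base with sign (-1)^(m+1). -/
theorem boundary_cone_succ {p : P} {m : ℕ} {c : (Fin (m + 1) ↪o P) →₀ k}
    (hc : c ∈ chains k (orderComplex (Set.Iio p)) (m + 1)) :
    boundary k (m + 1) (cone k p (m + 1) c)
      = cone k p m (boundary k m c) + (-1 : k) ^ (m + 1) • c := by
  refine eq_of_mem_supported (f := (boundary k (m + 1)).comp (cone k p (m + 1)))
    (g := (cone k p m).comp (boundary k m) + (-1 : k) ^ (m + 1) • LinearMap.id) ?_ hc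
  intro s hs
  have hs' : ∀ i, s i < p := hs
  rw [LinearMap.comp_apply, cone_single k hs', boundary_single, Fin.sum_univ_castSucc,
    LinearMap.add_apply, LinearMap.comp_apply, boundary_single, map_sum]
  congr 1
  · refine Finset.sum_congr rfl fun i _ => ?_
    have hi : ∀ j, face s i j < p := fun _ => hs' _
    rw [face_snocEmb_castSucc s p hs' i hi, map_smul, cone_single k hi, Fin.val_castSucc]
  · rw [face_last_snocEmb, Fin.val_last]
    rfl

theorem boundary_cone_of_mem_cycles {p : P} {m : ℕ} {c : (Fin m ↪o P) →₀ k}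
    (hc : c ∈ cycles k (orderComplex (Set.Iio p)) m) :
    boundary k m (cone k p m c) = (-1 : k) ^ m • c := by
  cases m with
  | zero => simp [boundary_cone_zero]
  | succ m => rw [boundary_cone_succ hc.1, LinearMap.mem_ker.1 hc.2, map_zero, zero_add]

/-- As p is maximal in S, a simplex through p ends at p, so it is the cone over its last face. -/
theorem exists_add_cone {S : Set P} {p : P} (hp : ∀ q ∈ S, p ≤ q → q = p) {m : ℕ}
    {z : (Fin (m + 1) ↪o P) →₀ k} (hz : z ∈ chains k (orderComplex S) (m + 1)) :
    ∃ z₀ ∈ chains k (orderComplex (S \ {p})) (m + 1),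
      ∃ y ∈ chains k (orderComplex (Set.Iio p)) m, z = z₀ + cone k p m y := by
  have key : z ∈ chains k (orderComplex (S \ {p})) (m + 1) ⊔
      (chains k (orderComplex (Set.Iio p)) m).map (cone k p m) := by
    refine map_mem_of_mem_supported (f := LinearMap.id) ?_ hz
    intro s hs
    by_cases h : s (Fin.last m) = p
    · refine Submodule.mem_sup_right
        ⟨Finsupp.single (face s (Fin.last m)) 1, ?_, ?_⟩
      · exact Finsupp.single_mem_supported k _ fun i => h ▸ face_last_lt s i
      · subst h
        rw [cone_single k (face_last_lt s), snocEmb_face_last]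
        rfl
    · refine Submodule.mem_sup_left (Finsupp.single_mem_supported k _ fun i => ⟨hs i, ?_⟩)
      intro hi
      exact h (hp _ (hs _) ((show s i = p from hi) ▸ s.monotone (Fin.le_last i)))
  obtain ⟨z₀, hz₀, _, ⟨y, hy, rfl⟩, rfl⟩ := Submodule.mem_sup.1 key
  exact ⟨z₀, hz₀, y, hy, rfl⟩

end Cone

/-! ### Complexes of vector spaces with a basis graded by a poset -/

/-- An augmented sequence of vector spaces and linear maps, with bases whose elements in positive
position have degrees in the poset `P`. -/
structure BasedComplex (k : Type v) [Field k] (P : Type u) where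
  /-- The index set of the basis in position `m`. -/
  ι : ℕ → Type
  /-- The degree of a basis element. -/
  deg : ∀ m, ι (m + 1) → P
  /-- The differential. -/
  d : ∀ m, (ι (m + 1) →₀ k) →ₗ[k] (ι m →₀ k)

namespace BasedComplex

variable {k : Type v} [Field k] {P : Type u} [PartialOrder P] (C : BasedComplex k P)

/-- The span of the basis elements of degree in `S`, and of all of those in position `0`. -/
def fil (S : Set P) : ∀ m, Submodule k (C.ι m →₀ k)
  -- This mirrors the empty simplex, which lies in every order complex, even that of the empty set.
  | 0 => ⊤
  | m + 1 => Finsupp.supported k k {t | C.deg m t ∈ S}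

/-- The cycles. -/
def cyc : ∀ m, Submodule k (C.ι m →₀ k)
  | 0 => ⊤
  | m + 1 => LinearMap.ker (C.d m)

/-- The complex has a single basis element in position `0`, the differential strictly lowers
degrees, and the elements of degree at most `p` form an exact complex, for every `p`. -/
structure IsAcyclic : Prop where
  existsUnique : ∃ t : C.ι 0, ∀ t', t' = t
  d_d : ∀ m c, C.d m (C.d (m + 1) c) = 0
  d_mem : ∀ m t, C.d m (Finsupp.single t 1) ∈ C.fil (Set.Iio (C.deg m t)) m
  exact : ∀ p m, ∀ c ∈ C.fil (Set.Iic p) m, c ∈ C.cyc m →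
    ∃ c' ∈ C.fil (Set.Iic p) (m + 1), C.d m c' = c

/-! ### Comparison with the order complex -/

/-- The comparison map to the chains of the order complex of `P`. -/
def toChains : ∀ m, (C.ι m →₀ k) →ₗ[k] ((Fin m ↪o P) →₀ k)
  | 0 => Finsupp.lmapDomain k k fun _ => RelEmbedding.ofIsEmpty _ _
  | m + 1 => Finsupp.lsum k fun t => LinearMap.toSpanSingleton k _
      -- The sign cancels the one in `boundary_cone_of_mem_cycles`, so that a chain map results.
      ((-1 : k) ^ m • cone k (C.deg m t) m (toChains m (C.d m (Finsupp.single t 1))))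

variable {C}

omit [PartialOrder P] in
theorem fil_mono {S T : Set P} (h : S ⊆ T) (m : ℕ) : C.fil S m ≤ C.fil T m := by
  cases m with
  | zero => exact le_rfl
  | succ m => exact Finsupp.supported_mono fun t ht => h ht

theorem toChains_single (m : ℕ) (t : C.ι (m + 1)) :
    C.toChains (m + 1) (Finsupp.single t 1)
      = (-1 : k) ^ m • cone k (C.deg m t) m (C.toChains m (C.d m (Finsupp.single t 1))) := by
  simp [toChains]

theorem chains_zero (Q : Set P) : chains k (orderComplex Q) 0 = ⊤ := by
  have : (orderComplex Q).faces 0 = Set.univ := Set.eq_univ_of_forall fun s i => i.elim0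
  rw [chains, this, Finsupp.supported_univ]

theorem toChains_mem {S : Set P} (hS : IsLowerSet S) (m : ℕ) {c : C.ι m →₀ k}
    (hc : c ∈ C.fil S m) : C.toChains m c ∈ chains k (orderComplex S) m := by
  cases m with
  | zero => rw [chains_zero]; trivial
  | succ m =>
    refine map_mem_of_mem_supported ?_ hc
    intro t ht
    rw [toChains_single]
    exact Submodule.smul_mem _ _ (cone_mem (fun q hq => hS hq ht) _)

namespace IsAcyclic

variable (hC : C.IsAcyclic)
include hC

theorem d_mem_Iio {p : P} (m : ℕ) {v : C.ι (m + 1) →₀ k}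
    (hv : v ∈ Finsupp.supported k k {t | C.deg m t = p}) : C.d m v ∈ C.fil (Set.Iio p) m :=
  map_mem_of_mem_supported (fun t (ht : C.deg m t = p) => ht ▸ hC.d_mem m t) hv

theorem d_mem_cyc (m : ℕ) (c : C.ι (m + 1) →₀ k) : C.d m c ∈ C.cyc m := by
  cases m with
  | zero => trivial
  | succ m => exact hC.d_d m c

/-- By induction the image of d t is a cycle, and it is supported below deg t; the boundary of its
cone is then the cycle itself up to sign. -/
theorem toChains_d (m : ℕ) : ∀ c : C.ι (m + 1) →₀ k,
    boundary k m (C.toChains (m + 1) c) = C.toChains m (C.d m c) := by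
  induction m with
  | zero =>
    intro c
    refine LinearMap.congr_fun (f := (boundary k 0).comp (C.toChains 1))
      (g := (C.toChains 0).comp (C.d 0)) (Finsupp.lhom_ext' fun t => LinearMap.ext_ring ?_) c
    simp only [LinearMap.comp_apply, Finsupp.lsingle_apply]
    rw [toChains_single, map_smul, boundary_cone_zero, pow_zero, one_smul]
  | succ m ih =>
    intro c
    refine LinearMap.congr_fun (f := (boundary k (m + 1)).comp (C.toChains (m + 2)))
      (g := (C.toChains (m + 1)).comp (C.d (m + 1)))
      (Finsupp.lhom_ext' fun t => LinearMap.ext_ring ?_) c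
    simp only [LinearMap.comp_apply, Finsupp.lsingle_apply]
    rw [toChains_single, map_smul, boundary_cone_of_mem_cycles, smul_smul, ← mul_pow,
      neg_one_mul, neg_neg, one_pow, one_smul]
    refine ⟨toChains_mem (isLowerSet_Iio _) _ (hC.d_mem _ t), ?_⟩
    exact LinearMap.mem_ker.2 (by rw [ih, hC.d_d, map_zero])

theorem toChains_mem_cycles {S : Set P} (hS : IsLowerSet S) (m : ℕ) {c : C.ι m →₀ k}
    (hc : c ∈ C.fil S m) (hc' : c ∈ C.cyc m) :
    C.toChains m c ∈ cycles k (orderComplex S) m := by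
  cases m with
  | zero => exact toChains_mem hS 0 hc
  | succ m =>
    refine ⟨toChains_mem hS _ hc, LinearMap.mem_ker.2 ?_⟩
    rw [hC.toChains_d, LinearMap.mem_ker.1 hc', map_zero]

omit hC in
theorem toChains_eq_cone {p : P} (m : ℕ) {v : C.ι (m + 1) →₀ k}
    (hv : v ∈ Finsupp.supported k k {t | C.deg m t = p}) :
    C.toChains (m + 1) v = (-1 : k) ^ m • cone k p m (C.toChains m (C.d m v)) := by
  refine eq_of_mem_supported (f := C.toChains (m + 1))
    (g := (-1 : k) ^ m • (cone k p m).comp ((C.toChains m).comp (C.d m))) ?_ hv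
  rintro t rfl
  rw [toChains_single]
  rfl

theorem toChains_zero_surjective (y : (Fin 0 ↪o P) →₀ k) : ∃ c, C.toChains 0 c = y := by
  obtain ⟨t, -⟩ := hC.existsUnique
  refine ⟨Finsupp.single t (y (RelEmbedding.ofIsEmpty _ _)), ?_⟩
  have h : ∀ s : Fin 0 ↪o P, s = RelEmbedding.ofIsEmpty _ _ := fun s => by ext i; exact i.elim0
  ext s
  simp [toChains, h s]

theorem toChains_zero_injective : Function.Injective (C.toChains 0) := by
  obtain ⟨t, ht⟩ := hC.existsUnique
  refine Finsupp.mapDomain_injective fun a b _ => ?_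
  rw [ht a, ht b]

omit hC [PartialOrder P] in
theorem exists_add_of_mem_fil {S : Set P} (p : P) (m : ℕ) {c : C.ι (m + 1) →₀ k}
    (hc : c ∈ C.fil S (m + 1)) :
    ∃ v ∈ Finsupp.supported k k {t | C.deg m t = p},
      ∃ c₀ ∈ C.fil (S \ {p}) (m + 1), c = v + c₀ := by
  have key : c ∈ Finsupp.supported k k {t | C.deg m t = p} ⊔ C.fil (S \ {p}) (m + 1) := by
    refine map_mem_of_mem_supported (f := LinearMap.id) ?_ hc
    intro t ht
    by_cases h : C.deg m t = p
    · exact Submodule.mem_sup_left (Finsupp.single_mem_supported k _ h)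
    · exact Submodule.mem_sup_right (Finsupp.single_mem_supported k _ ⟨ht, h⟩)
  obtain ⟨v, hv, c₀, hc₀, rfl⟩ := Submodule.mem_sup.1 key
  exact ⟨v, hv, c₀, hc₀, rfl⟩

/-- An element of degree `p` whose differential is a boundary from lower degrees vanishes. -/
theorem eq_zero_of_d_eq_d {p : P} (m : ℕ) {v : C.ι (m + 1) →₀ k}
    (hv : v ∈ Finsupp.supported k k {t | C.deg m t = p}) {c : C.ι (m + 1) →₀ k}
    (hc : c ∈ C.fil (Set.Iio p) (m + 1)) (h : C.d m v = C.d m c) : v = 0 := by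
  have hv' : v ∈ C.fil (Set.Iic p) (m + 1) :=
    Finsupp.supported_mono (fun t (ht : C.deg m t = p) => ht.le) hv
  have hc' : c ∈ C.fil (Set.Iic p) (m + 1) := fil_mono (fun q (hq : q < p) => hq.le) _ hc
  have hker : v - c ∈ C.cyc (m + 1) := by
    change C.d m (v - c) = 0
    rw [map_sub, h, sub_self]
  obtain ⟨e, he, hde⟩ := hC.exact p (m + 1) (v - c) (Submodule.sub_mem _ hv' hc') hker
  -- Differentials of elements of degree ≤ p have no component of degree p; as v - c is one of them,
  -- its component v vanishes.
  have hlow : ∀ e ∈ C.fil (Set.Iic p) (m + 2), C.d (m + 1) e ∈ C.fil (Set.Iio p) (m + 1) :=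
    fun e he => map_mem_of_mem_supported (fun t (ht : C.deg (m + 1) t ≤ p) =>
      fil_mono (fun q (hq : q < _) => hq.trans_le ht) _ (hC.d_mem (m + 1) t)) he
  have h1 := hlow e he
  rw [hde] at h1
  have h2 : v ∈ C.fil (Set.Iio p) (m + 1) := by simpa using Submodule.add_mem _ h1 hc
  have h3 : v ∈ Finsupp.supported k k ({t | C.deg m t = p} ∩ {t | C.deg m t ∈ Set.Iio p}) := by
    rw [Finsupp.supported_inter]; exact ⟨hv, h2⟩
  have h4 : {t | C.deg m t = p} ∩ {t | C.deg m t ∈ Set.Iio p} = ∅ :=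
    Set.eq_empty_of_forall_notMem fun t ⟨h5, h6⟩ => (h6 : C.deg m t < p).ne h5
  rwa [h4, Finsupp.supported_empty, Submodule.mem_bot] at h3

/-- A cycle in degrees below `p` is homologous there to the differential of an element of degree
`p`. -/
theorem exists_single_degree {p : P} {m : ℕ} {c : C.ι m →₀ k} (hc : c ∈ C.fil (Set.Iio p) m)
    (hc' : c ∈ C.cyc m) :
    ∃ v ∈ Finsupp.supported k k {t | C.deg m t = p},
      ∃ w ∈ C.fil (Set.Iio p) (m + 1), c = C.d m v + C.d m w := by
  obtain ⟨e, he, rfl⟩ := hC.exact p m c (fil_mono (fun q (hq : q < p) => hq.le) _ hc) hc'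
  obtain ⟨v, hv, w, hw, rfl⟩ := exists_add_of_mem_fil p m he
  exact ⟨v, hv, w, fil_mono (fun q hq => lt_of_le_of_ne hq.1 hq.2) _ hw, map_add _ _ _⟩

/-! ### Quasi-isomorphism over lower sets -/

/-- The comparison map is a quasi-isomorphism over `S`, expressed as exactness of its cone. -/
def _root_.BettiLinear.BasedComplex.IsQuasiIso (C : BasedComplex k P) (S : Set P) : Prop :=
  -- The pair (z, c) is a cycle of the mapping cone, up to sign conventions, and (z', c') exhibits
  -- it as a boundary.
  ∀ m, ∀ z ∈ chains k (orderComplex S) (m + 1), ∀ c ∈ C.fil S m, c ∈ C.cyc m →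
    boundary k m z = C.toChains m c →
    ∃ c' ∈ C.fil S (m + 1), ∃ z' ∈ chains k (orderComplex S) (m + 2),
      C.d m c' = c ∧ z = C.toChains (m + 1) c' + boundary k (m + 1) z'

/-- Surjectivity on homology: the case c = 0 of the mapping cone condition. Position 0 is separate,
because that condition only concerns chains with at least one vertex. -/
theorem exists_of_mem_cycles {S : Set P} (hS : C.IsQuasiIso S) (m : ℕ)
    {y : (Fin m ↪o P) →₀ k} (hy : y ∈ cycles k (orderComplex S) m) :
    ∃ c ∈ C.fil S m, c ∈ C.cyc m ∧ ∃ y' ∈ chains k (orderComplex S) (m + 1),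
      y = C.toChains m c + boundary k m y' := by
  cases m with
  | zero =>
    obtain ⟨c, rfl⟩ := hC.toChains_zero_surjective y
    exact ⟨c, trivial, trivial, 0, Submodule.zero_mem _, by simp⟩
  | succ m =>
    obtain ⟨c, hc, y', hy', h, rfl⟩ := hS m y hy.1 0 (Submodule.zero_mem _) (Submodule.zero_mem _)
      (by rw [LinearMap.mem_ker.1 hy.2, map_zero])
    exact ⟨c, hc, h, y', hy', rfl⟩

/-- Over the empty set only position 0 survives, and there the comparison map is injective. -/
theorem isQuasiIso_empty : C.IsQuasiIso (∅ : Set P) := by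
  intro m z hz c hc _ h
  have hz0 : z = 0 := by
    have : (orderComplex (∅ : Set P)).faces (m + 1) = ∅ :=
      Set.eq_empty_of_forall_notMem fun s hs => hs 0
    rw [chains, this, Finsupp.supported_empty] at hz
    exact hz
  subst hz0
  refine ⟨0, Submodule.zero_mem _, 0, Submodule.zero_mem _, ?_, by simp⟩
  rw [map_zero] at h ⊢
  cases m with
  | zero => exact (hC.toChains_zero_injective (h.symm.trans (map_zero _).symm)).symm
  | succ m => simpa [fil] using Eq.symm (a := c) (by simpa [fil] using hc)

/-- A five lemma argument with explicit chains. Passing from S \ {p} to S adds the cones over Δ_p on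
one side and the elements of degree p on the other; `h2` matches these additions and `h1` handles
what remains. -/
theorem isQuasiIso_step {S : Set P} (hS : IsLowerSet S) {p : P} (hpS : p ∈ S)
    (hp : ∀ q ∈ S, p ≤ q → q = p) (h1 : C.IsQuasiIso (S \ {p})) (h2 : C.IsQuasiIso (Set.Iio p)) :
    C.IsQuasiIso S := by
  have hIic : Set.Iic p ⊆ S := fun q hq => hS hq hpS
  have hIio : Set.Iio p ⊆ S \ {p} := fun q hq => ⟨hIic (le_of_lt hq), ne_of_lt hq⟩
  have hlow : IsLowerSet (S \ {p}) := fun a b hba ha =>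
    ⟨hS hba ha.1, fun hb => ha.2 (hp a ha.1 ((show b = p from hb) ▸ hba))⟩
  have hnot : p ∉ S \ {p} := fun h => h.2 rfl
  have hirr : p ∉ Set.Iio p := lt_irrefl p
  have hsub : S \ {p} ⊆ S := Set.sdiff_subset
  have hmono : ∀ {Q Q' : Set P} (_ : Q ⊆ Q') m,
      chains k (orderComplex Q) m ≤ chains k (orderComplex Q') m :=
    fun h m => chains_mono k (orderComplex_mono h m)
  intro m z hz c hc hcyc hzc
  -- split off the part at `p`
  obtain ⟨z₀, hz₀, y, hy, rfl⟩ := exists_add_cone hp hz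
  -- Taking links of p in ∂z = `toChains` c shows that ∂y is, up to sign, the image of d v, where v
  -- is the part of c of degree p. By `h2`, d v is then a differential from degrees below p, so v =
  -- 0 and y is a cycle.
  have key : y ∈ cycles k (orderComplex (Set.Iio p)) m ∧ c ∈ C.fil (S \ {p}) m := by
    cases m with
    | zero => exact ⟨hy, trivial⟩
    | succ m =>
      obtain ⟨v, hv, c₀, hc₀, rfl⟩ := exists_add_of_mem_fil p m hc
      have hl := congrArg (link k p m) hzc
      rw [map_add, boundary_cone_succ hy, map_add, map_add, map_smul, map_add, map_add,
        link_eq_zero hnot (boundary_mem_chains k hz₀), link_cone (boundary_mem_chains k hy),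
        link_eq_zero hirr hy, toChains_eq_cone m hv, map_smul,
        link_cone (toChains_mem (isLowerSet_Iio p) m (hC.d_mem_Iio m hv)),
        link_eq_zero hnot (toChains_mem hlow _ hc₀), smul_zero, zero_add, add_zero, add_zero]
        at hl
      rw [← map_smul, ← map_smul] at hl
      obtain ⟨c', hc', -, -, hdc', -⟩ := h2 m y hy _
        (hC.d_mem_Iio m (Submodule.smul_mem _ _ hv)) (hC.d_mem_cyc m _) hl
      have hv0 := hC.eq_zero_of_d_eq_d m (Submodule.smul_mem _ ((-1 : k) ^ m) hv) hc' hdc'.symm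
      have hv1 : v = 0 := by
        have : (-1 : k) ^ m ≠ 0 := pow_ne_zero _ (neg_ne_zero.2 one_ne_zero)
        exact (smul_eq_zero.1 hv0).resolve_left this
      subst hv1
      rw [hv0, map_zero, map_zero] at hl
      exact ⟨⟨hy, hl⟩, by rwa [zero_add]⟩
  obtain ⟨hyc, hcS⟩ := key
  obtain ⟨e, he, hecyc, y', hy', rfl⟩ := hC.exists_of_mem_cycles h2 m hyc
  obtain ⟨u, hu, w, hw, rfl⟩ := hC.exists_single_degree he hecyc
  set ε : k := (-1 : k) ^ m with hε
  have hεε : ε * ε = 1 := by rw [hε, ← mul_pow, neg_one_mul, neg_neg, one_pow]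
  -- With this q, the cycle is y = `toChains` (d u) + ∂q, with u of degree p. Coning turns the first
  -- term into `toChains` (ε u), and the cone formula rewrites the cone of ∂q.
  set q := C.toChains (m + 1) w + y' with hq
  have hqmem : q ∈ chains k (orderComplex (Set.Iio p)) (m + 1) :=
    Submodule.add_mem _ (toChains_mem (isLowerSet_Iio p) _ hw) hy'
  have hcone : cone k p m (C.toChains m (C.d m u + C.d m w) + boundary k m y')
      = C.toChains (m + 1) (ε • u) + boundary k (m + 1) (cone k p (m + 1) q) + ε • q := by
    rw [boundary_cone_succ hqmem, map_smul, toChains_eq_cone m hu, smul_smul, ← hε, hεε,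
      one_smul, hq, map_add (boundary k m), hC.toChains_d, pow_succ, ← hε, map_add, add_assoc,
      map_add]
    simp only [map_add, mul_neg, mul_one, neg_smul]
    abel
  rw [hcone] at hz hzc ⊢
  have hueps : ε • u ∈ C.fil S (m + 1) := Submodule.smul_mem _ _
    (Finsupp.supported_mono (fun t (ht : C.deg m t = p) => (ht ▸ hpS : C.deg m t ∈ S)) hu)
  have hdu : C.d m (ε • u) ∈ C.fil (S \ {p}) m :=
    fil_mono hIio m (hC.d_mem_Iio m (Submodule.smul_mem _ _ hu))
  -- Subtracting `toChains` (ε u) and the boundary of the cone of q leaves a mapping cone cycle over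
  -- S \ {p}.
  obtain ⟨c', hc', z', hz', hdc', hz1⟩ := h1 m (z₀ + ε • q)
    (Submodule.add_mem _ hz₀ (Submodule.smul_mem _ _ (hmono hIio _ hqmem)))
    (c - C.d m (ε • u)) (Submodule.sub_mem _ hcS hdu)
    (Submodule.sub_mem _ hcyc (hC.d_mem_cyc m _)) (by
      have h3 : z₀ + ε • q = (z₀ + (C.toChains (m + 1) (ε • u)
          + boundary k (m + 1) (cone k p (m + 1) q) + ε • q))
          - C.toChains (m + 1) (ε • u) - boundary k (m + 1) (cone k p (m + 1) q) := by abel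
      rw [h3, map_sub, map_sub, hzc, boundary_boundary, hC.toChains_d, sub_zero, ← map_sub])
  refine ⟨ε • u + c', Submodule.add_mem _ hueps (fil_mono hsub _ hc'),
    cone k p (m + 1) q + z', Submodule.add_mem _ (cone_mem hIic _) (hmono hsub _ hz'), ?_, ?_⟩
  · rw [map_add, hdc', add_sub_cancel]
  · have h4 : z₀ + (C.toChains (m + 1) (ε • u)
          + boundary k (m + 1) (cone k p (m + 1) q) + ε • q) = C.toChains (m + 1) (ε • u)
          + boundary k (m + 1) (cone k p (m + 1) q) + (z₀ + ε • q) := by abel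
    rw [h4, hz1, map_add (C.toChains (m + 1)), map_add (boundary k (m + 1)) _ z']
    abel

/-- For p maximal in S, both S \ {p} and the set of elements below p are lower sets smaller than S,
so induction on the cardinality applies. -/
theorem isQuasiIso [Finite P] {S : Set P} (hS : IsLowerSet S) : C.IsQuasiIso S := by
  induction hN : S.ncard using Nat.strong_induction_on generalizing S with
  | _ N ih =>
    rcases S.eq_empty_or_nonempty with rfl | hne
    · exact hC.isQuasiIso_empty
    obtain ⟨p, hp⟩ := S.toFinite.exists_maximal hne
    have hmax : ∀ q ∈ S, p ≤ q → q = p := fun q hq hpq => (hp.eq_of_le hq hpq).symm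
    have hcard : (S \ {p}).ncard < N := hN ▸ Set.ncard_sdiff_singleton_lt_of_mem hp.prop
    have hIio : Set.Iio p ⊆ S \ {p} := fun q hq => ⟨hS (le_of_lt hq) hp.prop, ne_of_lt hq⟩
    refine hC.isQuasiIso_step hS hp.prop hmax (ih _ hcard ?_ rfl)
      (ih _ ((Set.ncard_le_ncard hIio).trans_lt hcard) (isLowerSet_Iio p) rfl)
    exact fun a b hba ha => ⟨hS hba ha.1, fun hb => ha.2 (hmax a ha.1 ((show b = p from hb) ▸ hba))⟩

end IsAcyclic

end BasedComplex

/-! ### The homology of Δ_p and the maps along covers -/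

theorem subquotient_mkQ_eq_zero {k : Type v} [Field k] {V : Type u} [AddCommGroup V] [Module k V]
    {Z B : Submodule k V} {z : Z} (h : (B.submoduleOf Z).mkQ z = 0) : z.1 ∈ B :=
  (Submodule.Quotient.mk_eq_zero (B.submoduleOf Z)).1 h

theorem restrict_of_mem {k : Type v} [Field k] {P : Type u} [PartialOrder P] {K : Subcomplex P}
    {m : ℕ} {c : (Fin m ↪o P) →₀ k} (hc : c ∈ chains k K m) : restrict k K m c = c := by
  classical
  ext s
  rw [restrict_apply]
  split_ifs with h
  · rfl
  · exact ((Finsupp.mem_supported' k c).1 hc s h).symm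

theorem restrict_of_mem_compl {k : Type v} [Field k] {P : Type u} [PartialOrder P]
    {K : Subcomplex P} {m : ℕ} {c : (Fin m ↪o P) →₀ k}
    (hc : c ∈ Finsupp.supported k k (K.faces m)ᶜ) : restrict k K m c = 0 := by
  classical
  ext s
  rw [restrict_apply]
  split_ifs with h
  · exact (Finsupp.mem_supported' k c).1 hc s (fun h' => h' h)
  · rfl

theorem posetMap_mk (k : Type v) [Field k] {P : Type u} [PartialOrder P] [Finite P] (m : ℕ)
    {α l : P} (h : l ⋖ α) (z : cycles k (deltaLT α) (m + 1))
    (z' : cycles k (deltaLT l) m)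
    (hz : boundary k m (restrict k (deltaLE l) (m + 1) z.1) = z'.1) :
    posetMap k m h (Submodule.Quotient.mk z) = Submodule.Quotient.mk z' := by
  have : z' = ⟨boundary k m (restrict k (deltaLE l) (m + 1) z.1), hz ▸ z'.2⟩ :=
    Subtype.ext hz.symm
  rw [this]
  rfl

namespace BasedComplex

variable {k : Type v} [Field k] {P : Type u} [PartialOrder P] {C : BasedComplex k P}

namespace IsAcyclic

variable (hC : C.IsAcyclic)

/-- The cycle of `Δ_p` attached to an element of degree `p`. -/
def cycleMap (m : ℕ) (p : P) :
    Finsupp.supported k k {t | C.deg m t = p} →ₗ[k] cycles k (deltaLT p) m :=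
  (((C.toChains m).comp (C.d m)).comp (Submodule.subtype _)).codRestrict _ fun v =>
    hC.toChains_mem_cycles (isLowerSet_Iio p) m (hC.d_mem_Iio m v.2) (hC.d_mem_cyc m v.1)

/-- The comparison of the elements of degree `p` with the homology of `Δ_p`. -/
def degreeMap (m : ℕ) (p : P) :
    Finsupp.supported k k {t | C.deg m t = p} →ₗ[k] posetSummand k m p :=
  (Submodule.mkQ _).comp (hC.cycleMap m p)

theorem cycleMap_val (m : ℕ) (p : P) (v : Finsupp.supported k k {t | C.deg m t = p}) :
    (hC.cycleMap m p v).1 = C.toChains m (C.d m v.1) :=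
  rfl

/-- If the image of d v bounds in Δ_p, the quasi-isomorphism makes d v a differential from degrees
below p, and then v = 0. -/
theorem degreeMap_injective [Finite P] (m : ℕ) (p : P) :
    Function.Injective (hC.degreeMap m p) := by
  suffices h : ∀ v, hC.degreeMap m p v = 0 → v = 0 from fun v v' hv =>
    sub_eq_zero.1 (h _ (by rw [map_sub, hv, sub_self]))
  intro v hv
  have hv' : (hC.cycleMap m p v).1 ∈ boundaries k (deltaLT p) m :=
    subquotient_mkQ_eq_zero hv
  obtain ⟨z, hz, hzv⟩ := hv'
  obtain ⟨c', hc', -, -, hdc', -⟩ := hC.isQuasiIso (isLowerSet_Iio p) m z hz _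
    (hC.d_mem_Iio m v.2) (hC.d_mem_cyc m v.1) hzv
  exact Subtype.ext (hC.eq_zero_of_d_eq_d m v.2 hc' hdc'.symm)

/-- A class of Δ_p comes from a cycle of C in degrees below p. Exactness in degrees ≤ p writes that
cycle as d v + d w, and the image of d w bounds in Δ_p. -/
theorem degreeMap_surjective [Finite P] (m : ℕ) (p : P) :
    Function.Surjective (hC.degreeMap m p) := by
  intro x
  obtain ⟨y, rfl⟩ := Submodule.Quotient.mk_surjective _ x
  obtain ⟨c, hc, hcyc, y', hy', hy⟩ :=
    hC.exists_of_mem_cycles (hC.isQuasiIso (isLowerSet_Iio p)) m y.2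
  obtain ⟨v, hv, w, hw, rfl⟩ := hC.exists_single_degree hc hcyc
  refine ⟨⟨v, hv⟩, ?_⟩
  refine (Submodule.Quotient.eq _).2 ?_
  change (hC.cycleMap m p ⟨v, hv⟩).1 - y.1 ∈ boundaries k (deltaLT p) m
  refine ⟨-(C.toChains (m + 1) w + y'), Submodule.neg_mem _ (Submodule.add_mem _
    (toChains_mem (isLowerSet_Iio p) _ hw) hy'), ?_⟩
  rw [hy, cycleMap_val, map_neg, map_add, hC.toChains_d, map_add]
  abel

/-- The elements of degree `p` in the based complex give a basis of the homology of `Δ_p`. -/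
def degreeBasis [Finite P] (m : ℕ) (p : P) :
    Module.Basis {t : C.ι (m + 1) // C.deg m t = p} k (posetSummand k m p) :=
  Module.Basis.ofRepr
    ((LinearEquiv.ofBijective (hC.degreeMap m p)
      ⟨hC.degreeMap_injective m p, hC.degreeMap_surjective m p⟩).symm ≪≫ₗ
      Finsupp.supportedEquivFinsupp {t | C.deg m t = p})

theorem degreeBasis_apply [Finite P] (m : ℕ) (p : P) (t : {t : C.ι (m + 1) // C.deg m t = p}) :
    hC.degreeBasis m p t
      = hC.degreeMap m p ⟨Finsupp.single t.1 1, Finsupp.single_mem_supported k _ t.2⟩ := by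
  have h : (Finsupp.supportedEquivFinsupp {t | C.deg m t = p}).symm (Finsupp.single t (1 : k))
      = ⟨Finsupp.single t.1 1, Finsupp.single_mem_supported k _ t.2⟩ :=
    Subtype.ext (Finsupp.supportedEquivFinsupp_symm_single {t | C.deg m t = p} t (1 : k))
  exact congrArg (hC.degreeMap m p) h

/-- The image of w lies in Δ_{≤l}. The simplices in the image of c end at other elements covered by
α, which are not ≤ l, so restriction to Δ_{≤l} leaves the image of w, whose boundary is the cycle
attached to w. -/
theorem posetMap_degreeMap [Finite P] (m : ℕ) {α l : P} (h : l ⋖ α)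
    (v : Finsupp.supported k k {t | C.deg (m + 1) t = α})
    (w : Finsupp.supported k k {t | C.deg m t = l}) {c : C.ι (m + 1) →₀ k}
    (hc : c ∈ C.fil {β | l ≠ β ∧ β ⋖ α} (m + 1)) (hd : C.d (m + 1) v.1 = w.1 + c) :
    posetMap k m h (hC.degreeMap (m + 1) α v) = hC.degreeMap m l w := by
  refine posetMap_mk k m h (hC.cycleMap (m + 1) α v) (hC.cycleMap m l w) ?_
  have h1 : restrict k (deltaLE l) (m + 1) (C.toChains (m + 1) w.1) = C.toChains (m + 1) w.1 :=
    restrict_of_mem (toChains_mem (isLowerSet_Iic l) (m + 1)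
      (Finsupp.supported_mono (fun t (ht : C.deg m t = l) => ht.le) w.2))
  have h2 : restrict k (deltaLE l) (m + 1) (C.toChains (m + 1) c) = 0 := by
    refine restrict_of_mem_compl (map_mem_of_mem_supported ?_ hc)
    intro t ht
    rw [toChains_single]
    refine Submodule.smul_mem _ _ (Finsupp.supported_mono
      (s := {s : Fin (m + 1) ↪o P | s (Fin.last m) = C.deg m t}) ?_ (cone_mem_supported _))
    intro s hs hs'
    have hle : C.deg m t ≤ l := (show s (Fin.last m) = C.deg m t from hs) ▸ hs' (Fin.last m)
    exact ht.2.2 (lt_of_le_of_ne hle (Ne.symm ht.1)) h.lt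
  rw [cycleMap_val, cycleMap_val, hd, map_add, map_add, h1, h2, add_zero, hC.toChains_d]

theorem degreeBasis_repr_degreeMap [Finite P] (m : ℕ) (p : P)
    (w : Finsupp.supported k k {t | C.deg m t = p}) (g : {t : C.ι (m + 1) // C.deg m t = p}) :
    (hC.degreeBasis m p).repr (hC.degreeMap m p w) g = w.1 g.1 := by
  have h : (LinearEquiv.ofBijective (hC.degreeMap m p)
      ⟨hC.degreeMap_injective m p, hC.degreeMap_surjective m p⟩).symm (hC.degreeMap m p w) = w :=
    LinearEquiv.ofBijective_symm_apply_apply _ _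
  exact DFunLike.congr_fun
    (congrArg (Finsupp.supportedEquivFinsupp (M := k) (R := k) {t | C.deg m t = p}) h) g

/-- If the differential of a basis element only involves degrees covered by its degree, then its
coefficients are those of the differential of the poset construction. -/
theorem degreeBasis_repr_posetMap [Finite P] (m : ℕ) {α l : P} (h : l ⋖ α)
    (t : {t : C.ι (m + 2) // C.deg (m + 1) t = α})
    (ht : C.d (m + 1) (Finsupp.single t.1 1) ∈ C.fil {β | β ⋖ α} (m + 1))
    (g : {t : C.ι (m + 1) // C.deg m t = l}) :
    (hC.degreeBasis m l).repr (posetMap k m h (hC.degreeBasis (m + 1) α t)) g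
      = C.d (m + 1) (Finsupp.single t.1 1) g.1 := by
  obtain ⟨w, hw, c, hc, hd⟩ := exists_add_of_mem_fil l m ht
  have hc' : c ∈ C.fil {β | l ≠ β ∧ β ⋖ α} (m + 1) :=
    fil_mono (S := {β | β ⋖ α} \ {l}) (T := {β | l ≠ β ∧ β ⋖ α})
      (fun β hβ => ⟨Ne.symm hβ.2, hβ.1⟩) _ hc
  have hcg : c g.1 = 0 := (Finsupp.mem_supported' k c).1 hc g.1 fun hg => hg.2 g.2
  have hmap := hC.posetMap_degreeMap m h
    (⟨Finsupp.single t.1 1, Finsupp.single_mem_supported k _ t.2⟩ :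
      Finsupp.supported k k {t | C.deg (m + 1) t = α})
    (⟨w, hw⟩ : Finsupp.supported k k {t | C.deg m t = l}) hc' hd
  rw [degreeBasis_apply, hmap, degreeBasis_repr_degreeMap, hd, Finsupp.add_apply, hcg, add_zero]

end IsAcyclic

end BasedComplex

/-! ### Multigraded free modules -/

section Homogeneous

variable {k : Type v} [Field k] {n : ℕ}

theorem expZ_injective : Function.Injective (expZ (n := n)) := fun a b h => by
  ext j
  exact Int.natCast_inj.1 (congrFun h j)

theorem expZ_add (a b : Fin n →₀ ℕ) : expZ (a + b) = expZ a + expZ b := by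
  ext j
  simp [expZ]

theorem expZ_zero : expZ (0 : Fin n →₀ ℕ) = 0 := by
  ext j
  simp [expZ]

theorem expZ_nonneg (a : Fin n →₀ ℕ) : 0 ≤ expZ a := fun j => by simp [expZ]

theorem expZ_toNat {γ δ : Fin n → ℤ} (h : δ ≤ γ) :
    expZ (Finsupp.equivFunOnFinite.symm fun j => (γ j - δ j).toNat) + δ = γ := by
  ext j
  have hj : δ j ≤ γ j := h j
  simp only [expZ, Finsupp.equivFunOnFinite_symm_apply_apply, Pi.add_apply]
  omega

/-- Setting all variables equal to one. -/
abbrev evalOne (k : Type v) [Field k] (n : ℕ) : MvPolynomial (Fin n) k →+* k :=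
  MvPolynomial.eval fun _ => 1

theorem evalOne_monomial (a : Fin n →₀ ℕ) (c : k) :
    evalOne k n (MvPolynomial.monomial a c) = c := by
  simp [MvPolynomial.eval_monomial]

variable {M : Type u} [AddCommGroup M] [Module (MvPolynomial (Fin n) k) M] {ι : Type}
  {N : Type w} [AddCommGroup N] [Module (MvPolynomial (Fin n) k) N] {κ : Type}

/-- The elements that are homogeneous of degree `γ`. -/
def homogeneousSubgroup (b : Module.Basis ι (MvPolynomial (Fin n) k) M) (deg : ι → Fin n → ℤ)
    (γ : Fin n → ℤ) : AddSubgroup M where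
  carrier := {x | IsHomogeneousOf b deg x γ}
  zero_mem' t a ha := by simp at ha
  add_mem' {x y} hx hy t a ha := by
    classical
    rw [map_add, Finsupp.add_apply] at ha
    rcases Finset.mem_union.1 (MvPolynomial.support_add ha) with h | h
    exacts [hx t a h, hy t a h]
  neg_mem' {x} hx t a ha := by
    rw [map_neg, Finsupp.neg_apply, MvPolynomial.support_neg] at ha
    exact hx t a ha

variable {b : Module.Basis ι (MvPolynomial (Fin n) k) M} {deg : ι → Fin n → ℤ}
  {b' : Module.Basis κ (MvPolynomial (Fin n) k) N} {deg' : κ → Fin n → ℤ}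

theorem mem_of_monomial_smul_mem (b : Module.Basis ι (MvPolynomial (Fin n) k) M)
    (A : AddSubmonoid M) {x : M}
    (h : ∀ t, ∀ a ∈ (b.repr x t).support, ∀ c : k, MvPolynomial.monomial a c • b t ∈ A) :
    x ∈ A := by
  rw [← b.linearCombination_repr x, Finsupp.linearCombination_apply, Finsupp.sum]
  refine sum_mem fun t _ => ?_
  rw [MvPolynomial.as_sum (b.repr x t), Finset.sum_smul]
  exact sum_mem fun a ha => h t a ha _

namespace IsHomogeneousOf

theorem monomial_smul {x : M} {γ : Fin n → ℤ} (hx : IsHomogeneousOf b deg x γ)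
    (a : Fin n →₀ ℕ) (c : k) :
    IsHomogeneousOf b deg (MvPolynomial.monomial a c • x) (expZ a + γ) := by
  classical
  intro t a' ha'
  rw [map_smul, Finsupp.smul_apply, smul_eq_mul] at ha'
  obtain ⟨a₁, h₁, a₂, h₂, rfl⟩ := Finset.mem_add.1 (MvPolynomial.support_mul _ _ ha')
  rw [Finset.mem_singleton.1 (MvPolynomial.support_monomial_subset h₁), expZ_add, add_assoc,
    hx t a₂ h₂]

theorem basis (t : ι) : IsHomogeneousOf b deg (b t) (deg t) := by
  classical
  intro t' a ha
  rw [b.repr_self, Finsupp.single_apply] at ha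
  split_ifs at ha with h
  · subst h
    rw [← MvPolynomial.C_1, MvPolynomial.C_apply] at ha
    rw [Finset.mem_singleton.1 (MvPolynomial.support_monomial_subset ha), expZ_zero, zero_add]
  · simp at ha

theorem map (f : M →ₗ[MvPolynomial (Fin n) k] N)
    (hf : ∀ t, IsHomogeneousOf b' deg' (f (b t)) (deg t)) {x : M} {γ : Fin n → ℤ}
    (hx : IsHomogeneousOf b deg x γ) : IsHomogeneousOf b' deg' (f x) γ := by
  refine mem_of_monomial_smul_mem b
    ((homogeneousSubgroup b' deg' γ).comap f.toAddMonoidHom).toAddSubmonoid fun t a ha c => ?_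
  change IsHomogeneousOf b' deg' (f _) γ
  rw [map_smul, ← hx t a ha]
  exact (hf t).monomial_smul a c

theorem coeff_eq_zero {x : M} {γ : Fin n → ℤ} (hx : IsHomogeneousOf b deg x γ) {t : ι}
    {a : Fin n →₀ ℕ} (h : expZ a + deg t ≠ γ) : (b.repr x t).coeff a = 0 := by
  by_contra h'
  exact h (hx t a (MvPolynomial.mem_support_iff.2 h'))

theorem exists_decomposition (b : Module.Basis ι (MvPolynomial (Fin n) k) M)
    (deg : ι → Fin n → ℤ) (y : M) :
    ∃ g : (Fin n → ℤ) →₀ M, (∀ γ, IsHomogeneousOf b deg (g γ) γ) ∧ g.sum (fun _ x => x) = y := by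
  classical
  let A : AddSubmonoid M :=
    { carrier := {y | ∃ g : (Fin n → ℤ) →₀ M, (∀ γ, IsHomogeneousOf b deg (g γ) γ) ∧
        g.sum (fun _ x => x) = y}
      zero_mem' := ⟨0, fun γ => (homogeneousSubgroup b deg γ).zero_mem, Finsupp.sum_zero_index⟩
      add_mem' := by
        rintro _ _ ⟨g, hg, rfl⟩ ⟨g', hg', rfl⟩
        exact ⟨g + g', fun γ => (homogeneousSubgroup b deg γ).add_mem (hg γ) (hg' γ),
          Finsupp.sum_add_index' (fun _ => rfl) (fun _ _ _ => rfl)⟩ }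
  refine mem_of_monomial_smul_mem b A fun t a _ c => ?_
  refine ⟨Finsupp.single (expZ a + deg t) (MvPolynomial.monomial a c • b t), fun γ => ?_,
    Finsupp.sum_single_index rfl⟩
  rw [Finsupp.single_apply]
  split_ifs with h
  · exact h ▸ (basis t).monomial_smul a c
  · exact (homogeneousSubgroup b deg γ).zero_mem

/-- A homogeneous element in the image of a degree preserving map is the image of a homogeneous
element. -/
theorem exists_lift (f : M →ₗ[MvPolynomial (Fin n) k] N)
    (hf : ∀ t, IsHomogeneousOf b' deg' (f (b t)) (deg t)) {y : M} {γ : Fin n → ℤ}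
    (hy : IsHomogeneousOf b' deg' (f y) γ) : ∃ y', IsHomogeneousOf b deg y' γ ∧ f y' = f y := by
  classical
  obtain ⟨g, hg, rfl⟩ := exists_decomposition b deg y
  have hfg : ∀ γ, IsHomogeneousOf b' deg' (f (g γ)) γ := fun γ => (hg γ).map f hf
  -- The component of degree γ suffices: f preserves degrees, so the other components contribute
  -- nothing in degree γ.
  refine ⟨g γ, hg γ, b'.repr.injective ?_⟩
  ext t a
  by_cases h : expZ a + deg' t = γ
  · rw [Finsupp.sum, map_sum, map_sum, Finsupp.finsetSum_apply, MvPolynomial.coeff_sum,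
      Finset.sum_eq_single γ]
    · intro γ' _ hne
      exact (hfg γ').coeff_eq_zero fun h' => hne (h'.symm.trans h)
    · intro hγ
      rw [Finsupp.notMem_support_iff.1 hγ]
      simp
  · rw [(hfg γ).coeff_eq_zero h, hy.coeff_eq_zero h]

/-- Homogeneity does not depend on the choice of a multigraded basis. -/
theorem iff_of_basis {ι' : Type} {b₁ : Module.Basis ι' (MvPolynomial (Fin n) k) M}
    {deg₁ : ι' → Fin n → ℤ} (h : ∀ t, IsHomogeneousOf b deg (b₁ t) (deg₁ t)) {x : M}
    {γ : Fin n → ℤ} : IsHomogeneousOf b deg x γ ↔ IsHomogeneousOf b₁ deg₁ x γ := by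
  constructor
  · intro hx
    obtain ⟨y, hy, rfl⟩ := exists_lift (b := b₁) (deg := deg₁) LinearMap.id h hx
    exact hy
  · exact map LinearMap.id h

/-- The degree determines the only exponent that a coordinate can contain. Homogeneous elements are
thus recovered from their values at x = (1, …, 1). -/
theorem repr_eq {x : M} {γ : Fin n → ℤ} (hx : IsHomogeneousOf b deg x γ) (t : ι) :
    b.repr x t = evalOne k n (b.repr x t) • monomialSub k γ (deg t) := by
  by_cases h : b.repr x t = 0
  · simp [h]
  · obtain ⟨a, ha⟩ := Finset.nonempty_iff_ne_empty.2 (mt MvPolynomial.support_eq_empty.1 h)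
    have hat := hx t a ha
    have hsupp : b.repr x t = MvPolynomial.monomial a ((b.repr x t).coeff a) := by
      ext a'
      rw [MvPolynomial.coeff_monomial]
      split_ifs with h'
      · rw [h']
      · exact hx.coeff_eq_zero fun h'' =>
          h' (expZ_injective (add_right_cancel (hat.trans h''.symm)))
    have hle : deg t ≤ γ := hat ▸ le_add_of_nonneg_left (expZ_nonneg a)
    have ha' : Finsupp.equivFunOnFinite.symm (fun j => (γ j - deg t j).toNat) = a :=
      expZ_injective (add_right_cancel ((expZ_toNat hle).trans hat.symm))
    rw [hsupp, evalOne_monomial, monomialSub, ha', MvPolynomial.smul_monomial, smul_eq_mul,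
      mul_one]

theorem le_of_repr_ne_zero {x : M} {γ : Fin n → ℤ} (hx : IsHomogeneousOf b deg x γ) {t : ι}
    (h : b.repr x t ≠ 0) : deg t ≤ γ := by
  obtain ⟨a, ha⟩ := Finset.nonempty_iff_ne_empty.2 (mt MvPolynomial.support_eq_empty.1 h)
  exact hx t a ha ▸ le_add_of_nonneg_left (expZ_nonneg a)

end IsHomogeneousOf

/-! ### Dehomogenization -/

/-- Setting all variables equal to one in a free module. -/
def dehomogenize (b : Module.Basis ι (MvPolynomial (Fin n) k) M) :
    M →ₛₗ[evalOne k n] (ι →₀ k) where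
  toFun x := Finsupp.mapRange (evalOne k n) (map_zero _) (b.repr x)
  map_add' x y := by
    ext t
    simp
  map_smul' p x := by
    ext t
    simp

theorem dehomogenize_apply (x : M) (t : ι) :
    dehomogenize b x t = evalOne k n (b.repr x t) :=
  rfl

theorem dehomogenize_basis (t : ι) : dehomogenize b (b t) = Finsupp.single t 1 := by
  classical
  ext t'
  rw [dehomogenize_apply, b.repr_self, Finsupp.single_apply, Finsupp.single_apply, apply_ite
    (evalOne k n), map_one, map_zero]

theorem dehomogenize_mem {x : M} {γ : Fin n → ℤ} (hx : IsHomogeneousOf b deg x γ) :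
    dehomogenize b x ∈ Finsupp.supported k k {t | deg t ≤ γ} := by
  refine (Finsupp.mem_supported k _).2 fun t ht => hx.le_of_repr_ne_zero fun h => ?_
  have : dehomogenize b x t ≠ 0 := Finsupp.mem_support_iff.1 ht
  exact this (by rw [dehomogenize_apply, h, map_zero])

theorem IsHomogeneousOf.eq_zero_of_dehomogenize {x : M} {γ : Fin n → ℤ}
    (hx : IsHomogeneousOf b deg x γ) (h : dehomogenize b x = 0) : x = 0 := by
  refine b.repr.map_eq_zero_iff.1 (Finsupp.ext fun t => ?_)
  rw [hx.repr_eq t, ← dehomogenize_apply, h]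
  simp

/-- With `eq_zero_of_dehomogenize`, this identifies the elements of degree γ with the vectors
supported in degrees ≤ γ. -/
theorem exists_dehomogenize_eq {γ : Fin n → ℤ} {c : ι →₀ k}
    (hc : c ∈ Finsupp.supported k k {t | deg t ≤ γ}) :
    ∃ x, IsHomogeneousOf b deg x γ ∧ dehomogenize b x = c := by
  refine ⟨∑ t ∈ c.support, MvPolynomial.monomial
    (Finsupp.equivFunOnFinite.symm fun j => (γ j - deg t j).toNat) (c t) • b t, ?_, ?_⟩
  · refine AddSubgroup.sum_mem (homogeneousSubgroup b deg γ) fun t ht => ?_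
    have hle : deg t ≤ γ := (Finsupp.mem_supported k c).1 hc ht
    have h := (IsHomogeneousOf.basis (b := b) (deg := deg) t).monomial_smul
      (Finsupp.equivFunOnFinite.symm fun j => (γ j - deg t j).toNat) (c t)
    rwa [expZ_toNat hle] at h
  · rw [map_sum]
    conv_rhs => rw [← Finsupp.sum_single c]
    refine Finset.sum_congr rfl fun t _ => ?_
    rw [LinearMap.map_smulₛₗ, dehomogenize_basis, evalOne_monomial, Finsupp.smul_single_one]

/-- Exactness passes to the dehomogenization of the part of degree `γ`. -/
theorem exists_of_exact {L : Type*} [AddCommGroup L] [Module (MvPolynomial (Fin n) k) L]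
    {μ : Type} {b'' : Module.Basis μ (MvPolynomial (Fin n) k) L} {deg'' : μ → Fin n → ℤ}
    {f : M →ₗ[MvPolynomial (Fin n) k] N} {g : N →ₗ[MvPolynomial (Fin n) k] L}
    (hf : ∀ t, IsHomogeneousOf b' deg' (f (b t)) (deg t))
    (hg : ∀ t, IsHomogeneousOf b'' deg'' (g (b' t)) (deg' t)) (hfg : Function.Exact f g)
    {T : (κ →₀ k) →ₗ[k] (μ →₀ k)} (hT : ∀ x, T (dehomogenize b' x) = dehomogenize b'' (g x))
    {γ : Fin n → ℤ} {c : κ →₀ k} (hc : c ∈ Finsupp.supported k k {t | deg' t ≤ γ})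
    (hTc : T c = 0) :
    ∃ y, IsHomogeneousOf b deg y γ ∧ dehomogenize b' (f y) = c := by
  obtain ⟨x, hx, rfl⟩ := exists_dehomogenize_eq (b := b') hc
  rw [hT] at hTc
  obtain ⟨y, rfl⟩ := (hfg x).1 ((hx.map g hg).eq_zero_of_dehomogenize hTc)
  obtain ⟨y', hy', hyy'⟩ := IsHomogeneousOf.exists_lift f hf hx
  exact ⟨y', hy', by rw [hyy']⟩

end Homogeneous

/-! ### The dehomogenized resolution -/

theorem constantCoeff_repr_eq_zero {k : Type v} [Field k] {n : ℕ} {M : Type u} [AddCommGroup M]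
    [Module (MvPolynomial (Fin n) k) M] {ι : Type}
    (b : Module.Basis ι (MvPolynomial (Fin n) k) M) {x : M}
    (hx : x ∈ Ideal.span (Set.range (MvPolynomial.X : Fin n → MvPolynomial (Fin n) k)) •
      (⊤ : Submodule (MvPolynomial (Fin n) k) M)) (t : ι) :
    MvPolynomial.constantCoeff (b.repr x t) = 0 := by
  have hspan : Ideal.span (Set.range (MvPolynomial.X : Fin n → MvPolynomial (Fin n) k)) ≤
      RingHom.ker (MvPolynomial.constantCoeff (R := k) (σ := Fin n)) := by
    rw [Ideal.span_le]
    rintro _ ⟨j, rfl⟩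
    exact MvPolynomial.constantCoeff_X (R := k) j
  induction hx using Submodule.smul_induction_on' with
  | smul p hp y _ =>
    rw [map_smul, Finsupp.smul_apply, smul_eq_mul, map_mul,
      (RingHom.mem_ker).1 (hspan hp), zero_mul]
  | add x _ y _ hx hy => rw [map_add, Finsupp.add_apply, map_add, hx, hy, add_zero]

namespace MinimalResolution

variable {k : Type v} [Field k] {n : ℕ} {I : Ideal (MvPolynomial (Fin n) k)}
  (F : MinimalResolution.{u} I)

theorem constantCoeff_repr_d (i : ℕ) (x : F.F (i + 1)) (t : Fin (F.rank i)) :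
    MvPolynomial.constantCoeff ((F.basis i).repr (F.d i x) t) = 0 :=
  constantCoeff_repr_eq_zero _ (F.minimal i ⟨x, rfl⟩) t

/-- This is the form in which minimality is used to show that the differential and the augmentation
do not vanish on basis elements. -/
theorem basis_ne_d (i : ℕ) (t : Fin (F.rank i)) (x : F.F (i + 1)) : F.d i x ≠ F.basis i t := by
  intro h
  have := F.constantCoeff_repr_d i x t
  rw [h, Module.Basis.repr_self, Finsupp.single_eq_same, map_one] at this
  exact one_ne_zero this

theorem aug_basis_ne_zero (t : Fin (F.rank 0)) : F.aug (F.basis 0 t) ≠ 0 := fun h => by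
  obtain ⟨x, hx⟩ := (F.exact_zero _).1 h
  exact F.basis_ne_d 0 t x hx

theorem d_basis_ne_zero (i : ℕ) (t : Fin (F.rank (i + 1))) : F.d i (F.basis (i + 1) t) ≠ 0 :=
  fun h => by
    obtain ⟨x, hx⟩ := (F.exact_succ i _).1 h
    exact F.basis_ne_d (i + 1) t x hx

/-- The differential strictly lowers degrees. -/
theorem mdeg_lt {i : ℕ} {t : Fin (F.rank (i + 1))} {g : Fin (F.rank i)}
    (h : (F.basis i).repr (F.d i (F.basis (i + 1) t)) g ≠ 0) :
    F.mdeg i g < F.mdeg (i + 1) t := by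
  -- If the degrees were equal, the coefficient would be a scalar, and minimality makes its constant
  -- term zero.
  refine lt_of_le_of_ne ((F.d_homogeneous i t).le_of_repr_ne_zero h) fun heq => h ?_
  have h0 := F.constantCoeff_repr_d i (F.basis (i + 1) t) g
  have hr := (F.d_homogeneous i t).repr_eq g
  have hone : monomialSub k (F.mdeg (i + 1) t) (F.mdeg i g) = 1 := by
    have : (Finsupp.equivFunOnFinite.symm fun j =>
        (F.mdeg (i + 1) t j - F.mdeg i g j).toNat : Fin n →₀ ℕ) = 0 := by
      ext j
      simp [heq]
    rw [monomialSub, this, ← MvPolynomial.C_apply, MvPolynomial.C_1]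
  rw [hone] at hr
  rw [hr] at h0
  rw [hr]
  rw [MvPolynomial.smul_eq_C_mul, mul_one, MvPolynomial.constantCoeff_C] at h0
  rw [h0, zero_smul]

theorem exists_repr_d_ne_zero (i : ℕ) (t : Fin (F.rank (i + 1))) :
    ∃ g, (F.basis i).repr (F.d i (F.basis (i + 1) t)) g ≠ 0 := by
  by_contra! h
  exact F.d_basis_ne_zero i t ((F.basis i).repr.map_eq_zero_iff.1 (Finsupp.ext h))

theorem exists_mdeg_zero_le : ∀ (i : ℕ) (t : Fin (F.rank i)), ∃ g, F.mdeg 0 g ≤ F.mdeg i t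
  | 0, t => ⟨t, le_rfl⟩
  | i + 1, t => by
    obtain ⟨g, hg⟩ := F.exists_repr_d_ne_zero i t
    obtain ⟨g', hg'⟩ := exists_mdeg_zero_le i g
    exact ⟨g', hg'.trans (F.mdeg_lt hg).le⟩

/-- The augmentation with all variables set to one. -/
def strandAug : (Fin (F.rank 0) →₀ k) →ₗ[k] (Unit →₀ k) :=
  Finsupp.linearCombination k fun t =>
    dehomogenize (Module.Basis.singleton Unit (MvPolynomial (Fin n) k)) (F.aug (F.basis 0 t))

/-- The differential with all variables set to one. -/
def strandD (i : ℕ) : (Fin (F.rank (i + 1)) →₀ k) →ₗ[k] (Fin (F.rank i) →₀ k) :=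
  Finsupp.linearCombination k fun t => dehomogenize (F.basis i) (F.d i (F.basis (i + 1) t))

theorem strandAug_single (t : Fin (F.rank 0)) :
    F.strandAug (Finsupp.single t 1)
      = dehomogenize (Module.Basis.singleton Unit (MvPolynomial (Fin n) k))
        (F.aug (F.basis 0 t)) := by
  rw [strandAug, Finsupp.linearCombination_single, one_smul]

theorem strandD_single (i : ℕ) (t : Fin (F.rank (i + 1))) :
    F.strandD i (Finsupp.single t 1)
      = dehomogenize (F.basis i) (F.d i (F.basis (i + 1) t)) := by
  rw [strandD, Finsupp.linearCombination_single, one_smul]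

theorem strandAug_dehomogenize (x : F.F 0) :
    F.strandAug (dehomogenize (F.basis 0) x)
      = dehomogenize (Module.Basis.singleton Unit (MvPolynomial (Fin n) k)) (F.aug x) := by
  have h : (LinearMap.comp F.strandAug (dehomogenize (F.basis 0)) :
      F.F 0 →ₛₗ[evalOne k n] (Unit →₀ k))
      = (dehomogenize (Module.Basis.singleton Unit (MvPolynomial (Fin n) k))).comp F.aug := by
    refine (F.basis 0).ext fun t => ?_
    rw [LinearMap.comp_apply, LinearMap.comp_apply, dehomogenize_basis, strandAug_single]
  exact LinearMap.congr_fun h x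

theorem strandD_dehomogenize (i : ℕ) (x : F.F (i + 1)) :
    F.strandD i (dehomogenize (F.basis (i + 1)) x) = dehomogenize (F.basis i) (F.d i x) := by
  have h : (LinearMap.comp (F.strandD i) (dehomogenize (F.basis (i + 1))) :
      F.F (i + 1) →ₛₗ[evalOne k n] (Fin (F.rank i) →₀ k))
      = (dehomogenize (F.basis i)).comp (F.d i) := by
    refine (F.basis (i + 1)).ext fun t => ?_
    rw [LinearMap.comp_apply, LinearMap.comp_apply, dehomogenize_basis, strandD_single]
  exact LinearMap.congr_fun h x

theorem strandAug_strandD (c : Fin (F.rank 1) →₀ k) : F.strandAug (F.strandD 0 c) = 0 := by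
  refine LinearMap.congr_fun (f := F.strandAug.comp (F.strandD 0)) (g := 0)
    (Finsupp.lhom_ext' fun t => LinearMap.ext_ring ?_) c
  simp only [LinearMap.comp_apply, Finsupp.lsingle_apply, LinearMap.zero_apply]
  rw [strandD_single, strandAug_dehomogenize, F.exact_zero.apply_apply_eq_zero, map_zero]

theorem strandD_strandD (i : ℕ) (c : Fin (F.rank (i + 2)) →₀ k) :
    F.strandD i (F.strandD (i + 1) c) = 0 := by
  refine LinearMap.congr_fun (f := (F.strandD i).comp (F.strandD (i + 1))) (g := 0)
    (Finsupp.lhom_ext' fun t => LinearMap.ext_ring ?_) c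
  simp only [LinearMap.comp_apply, Finsupp.lsingle_apply, LinearMap.zero_apply]
  rw [strandD_single, strandD_dehomogenize, (F.exact_succ i).apply_apply_eq_zero, map_zero]

theorem repr_d_ne_zero {i : ℕ} {t : Fin (F.rank (i + 1))} {g : Fin (F.rank i)}
    (h : F.strandD i (Finsupp.single t 1) g ≠ 0) :
    (F.basis i).repr (F.d i (F.basis (i + 1) t)) g ≠ 0 := fun h' => h <| by
  rw [strandD_single, dehomogenize_apply, h', map_zero]

theorem aug_isHomogeneousOf (t : Fin (F.rank 0)) :
    IsHomogeneousOf (Module.Basis.singleton Unit (MvPolynomial (Fin n) k)) (fun _ => 0)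
      (F.aug (F.basis 0 t)) (F.mdeg 0 t) := by
  intro _ a ha
  rw [Module.Basis.singleton_repr] at ha
  rw [add_zero]
  exact F.aug_homogeneous t a ha

theorem evalOne_aug_basis_ne_zero (t : Fin (F.rank 0)) :
    evalOne k n (F.aug (F.basis 0 t)) ≠ 0 := by
  intro h
  refine F.aug_basis_ne_zero t ((F.aug_isHomogeneousOf t).eq_zero_of_dehomogenize ?_)
  ext
  rw [dehomogenize_apply, Module.Basis.singleton_repr, h]
  rfl

theorem exists_strandAug_eq (t : Fin (F.rank 0)) (c : Unit →₀ k) :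
    ∃ r : k, F.strandAug (r • Finsupp.single t 1) = c := by
  refine ⟨c () / evalOne k n (F.aug (F.basis 0 t)), Finsupp.ext fun _ => ?_⟩
  rw [map_smul F.strandAug, strandAug_single, Finsupp.smul_apply, dehomogenize_apply,
    Module.Basis.singleton_repr, smul_eq_mul, div_mul_cancel₀ _ (F.evalOne_aug_basis_ne_zero t)]

/-- The index sets of the bases of the augmented resolution. -/
def strandIndex : ℕ → Type
  | 0 => Unit
  | i + 1 => Fin (F.rank i)

variable {P : Type w} (deg : ∀ i, Fin (F.rank i) → P)

/-- The augmented resolution with all variables set to one. -/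
def strand : BasedComplex k P where
  -- Position 0 comes from R and position i + 1 from F_i, so basis elements of F_i map to chains on
  -- i + 1 vertices.
  ι := F.strandIndex
  deg := deg
  d
    | 0 => F.strandAug
    | i + 1 => F.strandD i

variable [PartialOrder P] {deg} {η : P →o (Fin n → ℤ)}

/-- The dehomogenized resolution is acyclic in every degree in which the ideal is non-zero. -/
theorem strand_isAcyclic (hη : ∀ {p q}, η p ≤ η q → p ≤ q)
    (hdeg : ∀ i t, η (deg i t) = F.mdeg i t) (hP : ∀ p, ∃ t, F.mdeg 0 t ≤ η p) :
    (F.strand deg).IsAcyclic := by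
  have hle : ∀ {i t p}, F.mdeg i t ≤ η p → deg i t ≤ p := fun h => hη (by rwa [hdeg])
  have hle' : ∀ {i t p}, deg i t ≤ p → F.mdeg i t ≤ η p := fun h => hdeg _ _ ▸ η.monotone h
  have hlt : ∀ {i t g}, F.mdeg i g < F.mdeg (i + 1) t → deg i g < deg (i + 1) t := by
    intro i t g h
    rw [← hdeg, ← hdeg] at h
    exact lt_of_le_of_ne (hη h.le) fun h' => h.ne (congrArg η h')
  refine ⟨⟨(), fun _ => rfl⟩, ?_, ?_, ?_⟩
  · rintro (_ | m) c
    · exact F.strandAug_strandD c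
    · exact F.strandD_strandD m c
  · rintro (_ | m) t
    · trivial
    · exact (Finsupp.mem_supported k _).2 fun g hg =>
        hlt (F.mdeg_lt (F.repr_d_ne_zero (Finsupp.mem_support_iff.1 hg)))
  · intro p m c hc hcyc
    match m with
    | 0 =>
      -- Exactness in position 0 needs a generator of degree ≤ p; its image under the augmentation
      -- becomes a non-zero scalar.
      obtain ⟨t, ht⟩ := hP p
      obtain ⟨r, hr⟩ := F.exists_strandAug_eq t c
      exact ⟨r • Finsupp.single t 1,
        Submodule.smul_mem _ _ (Finsupp.single_mem_supported k _ (hle ht)), hr⟩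
    | 1 =>
      obtain ⟨y, hy, rfl⟩ := exists_of_exact (F.d_homogeneous 0) F.aug_isHomogeneousOf
        F.exact_zero F.strandAug_dehomogenize (γ := η p)
        (Finsupp.supported_mono (fun t (ht : deg 0 t ≤ p) => hle' ht) hc) hcyc
      exact ⟨_, Finsupp.supported_mono (fun t (ht : F.mdeg 1 t ≤ η p) => hle ht)
        (dehomogenize_mem hy), F.strandD_dehomogenize 0 y⟩
    | m + 2 =>
      obtain ⟨y, hy, rfl⟩ := exists_of_exact (F.d_homogeneous (m + 1)) (F.d_homogeneous m)
        (F.exact_succ m) (F.strandD_dehomogenize m) (γ := η p)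
        (Finsupp.supported_mono (fun t (ht : deg (m + 1) t ≤ p) => hle' ht) hc) hcyc
      exact ⟨_, Finsupp.supported_mono (fun t (ht : F.mdeg (m + 2) t ≤ η p) => hle ht)
        (dehomogenize_mem hy), F.strandD_dehomogenize (m + 1) y⟩

/-- Pure resolutions are Betti-linear. -/
theorem IsPure.isBettiLinear (hF : F.IsPure) : F.IsBettiLinear := by
  choose δ hδ using hF
  have hlt : ∀ {γ γ' : Fin n → ℤ}, γ < γ' → ∑ j, γ j < ∑ j, γ' j := fun h =>
    Finset.sum_lt_sum (fun j _ => (Pi.lt_def.1 h).1 j)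
      ((Pi.lt_def.1 h).2.imp fun j hj => ⟨Finset.mem_univ j, hj⟩)
  -- The element `t` is needed because δ i is arbitrary when F_i = 0. Its differential involves some
  -- basis element of F_{i-1}, which keeps the induction going.
  have hmono : ∀ i (t : Fin (F.rank i)), ∀ j ≤ i, δ j ≤ δ i := by
    intro i
    induction i with
    | zero => intro t j hj; rw [Nat.le_zero.1 hj]
    | succ i ih =>
      intro t j hj
      obtain ⟨g, hg⟩ := F.exists_repr_d_ne_zero i t
      have h := hlt (F.mdeg_lt hg)
      rw [hδ, hδ] at h
      rcases Nat.le_succ_iff.1 hj with hj | rfl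
      · exact (ih g j hj).trans h.le
      · exact le_rfl
  refine ⟨F.basis, fun i t => ⟨F.mdeg i t, i, t, rfl⟩, fun i t => .basis t, fun i t g h => ?_⟩
  refine ⟨F.mdeg_lt h, ?_⟩
  -- An intermediate degree, coming from F_j, would give δ i < δ j < δ (i + 1), against monotonicity
  -- whether j ≤ i or j > i.
  rintro ⟨_, j, s, rfl⟩ h₁ h₂
  have h₁ := hlt (show F.mdeg i g < F.mdeg j s from h₁)
  have h₂ := hlt (show F.mdeg j s < F.mdeg (i + 1) t from h₂)
  rw [hδ, hδ] at h₁ h₂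
  rcases le_or_gt j i with hj | hj
  · exact absurd (hmono i g j hj) (not_le.2 h₁)
  · exact absurd (hmono j s (i + 1) hj) (not_le.2 h₂)

end MinimalResolution

/-! ### Bases of the poset construction -/

section PosetBases

variable {k : Type v} [Field k] {n : ℕ}

section

variable {P : Type w} [PartialOrder P] {i : ℕ} {κ : P → Type}

/-- The basis of the free module `𝓕_i` formed by bases of the homology groups `𝒟_{i,l}`. -/
def posetBasis (n : ℕ) (b : ∀ l, Module.Basis (κ l) k (posetSummand k i l)) :
    Module.Basis (Σ l, κ l) (MvPolynomial (Fin n) k) (posetModule k P n i) :=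
  DFinsupp.basis fun l => (b l).baseChange (MvPolynomial (Fin n) k)

theorem posetBasis_repr (b : ∀ l, Module.Basis (κ l) k (posetSummand k i l))
    (x : posetModule k P n i) (s : Σ l, κ l) :
    (posetBasis n b).repr x s = ((b s.1).baseChange (MvPolynomial (Fin n) k)).repr (x s.1) s.2 := by
  rfl

open scoped Classical in
theorem posetBasis_apply (b : ∀ l, Module.Basis (κ l) k (posetSummand k i l)) (s : Σ l, κ l) :
    posetBasis n b s = DirectSum.lof (MvPolynomial (Fin n) k) P
      (fun l : P => MvPolynomial (Fin n) k ⊗[k] posetSummand k i l) s.1 (1 ⊗ₜ[k] b s.1 s.2) := by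
  refine (posetBasis n b).repr.injective (Finsupp.ext fun s' => ?_)
  rw [Module.Basis.repr_self, posetBasis_repr]
  obtain ⟨l, j⟩ := s
  obtain ⟨l', j'⟩ := s'
  by_cases h : l = l'
  · subst h
    rw [DirectSum.lof_apply, ← Module.Basis.baseChange_apply, Module.Basis.repr_self,
      Finsupp.single_apply, Finsupp.single_apply]
    simp
  · rw [DirectSum.lof_eq_of, DirectSum.of_eq_of_ne _ _ _ (Ne.symm h), map_zero, Finsupp.zero_apply,
      Finsupp.single_eq_of_ne]
    exact fun h' => h (congrArg Sigma.fst h').symm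

open scoped Classical in
theorem posetDifferential_lof [Finite P] (η : P →o (Fin n → ℤ)) (i : ℕ) (α l : P)
    (v : posetSummand k (i + 1) α) :
    posetDifferential k η i (DirectSum.lof (MvPolynomial (Fin n) k) P
      (fun l : P => MvPolynomial (Fin n) k ⊗[k] posetSummand k (i + 1) l) α (1 ⊗ₜ[k] v)) l
      = if h : l ⋖ α then monomialSub k (η α) (η l) • (1 ⊗ₜ[k] posetMap k i h v) else 0 := by
  have := Fintype.ofFinite {l : P // l ⋖ α}
  rw [posetDifferential, DirectSum.toModule_lof, finsum_eq_sum_of_fintype, LinearMap.sum_apply,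
    DirectSum.sum_apply]
  split_ifs with h
  · rw [Finset.sum_eq_single ⟨l, h⟩]
    · rw [LinearMap.comp_apply, DirectSum.lof_apply, LinearMap.smul_apply,
        LinearMap.baseChange_tmul]
    · intro l' _ hne
      rw [LinearMap.comp_apply, DirectSum.lof_eq_of, DirectSum.of_eq_of_ne]
      exact fun h' => hne (Subtype.ext h'.symm)
    · intro h'
      exact absurd (Finset.mem_univ _) h'
  · refine Finset.sum_eq_zero fun l' _ => ?_
    rw [LinearMap.comp_apply, DirectSum.lof_eq_of, DirectSum.of_eq_of_ne]
    rintro rfl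
    exact h l'.2

theorem posetBasis_repr_posetDifferential [Finite P] (η : P →o (Fin n → ℤ)) {κ' : P → Type}
    (b : ∀ l, Module.Basis (κ l) k (posetSummand k i l))
    (b' : ∀ l, Module.Basis (κ' l) k (posetSummand k (i + 1) l)) (s : Σ l, κ l) (s' : Σ l, κ' l)
    (h : ¬ s.1 ⋖ s'.1) :
    (posetBasis n b).repr (posetDifferential k η i (posetBasis n b' s')) s = 0 := by
  classical
  rw [posetBasis_repr, posetBasis_apply, posetDifferential_lof, dif_neg h, map_zero,
    Finsupp.zero_apply]

end

section Graded

variable {P : Type} [PartialOrder P] {i : ℕ} {κ : P → Type}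
  {M : Type u} [AddCommGroup M] [Module (MvPolynomial (Fin n) k) M]

theorem map_posetBasis_repr (b : ∀ l, Module.Basis (κ l) k (posetSummand k i l))
    (e : M ≃ₗ[MvPolynomial (Fin n) k] posetModule k P n i) (x : M) (s : Σ l, κ l) :
    ((posetBasis n b).map e.symm).repr x s
      = ((b s.1).baseChange (MvPolynomial (Fin n) k)).repr (e x s.1) s.2 :=
  rfl

open scoped Classical in
theorem monomial_smul_lof (l : P) (a : Fin n →₀ ℕ) (c : k) (v : posetSummand k i l) :
    MvPolynomial.monomial a c • DirectSum.lof (MvPolynomial (Fin n) k) P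
        (fun l : P => MvPolynomial (Fin n) k ⊗[k] posetSummand k i l) l (1 ⊗ₜ[k] v)
      = DirectSum.of (fun l : P => MvPolynomial (Fin n) k ⊗[k] posetSummand k i l) l
        (MvPolynomial.monomial a 1 ⊗ₜ[k] (c • v)) := by
  have h : MvPolynomial.monomial a c • ((1 : MvPolynomial (Fin n) k) ⊗ₜ[k] v)
      = MvPolynomial.monomial a (1 : k) ⊗ₜ[k] (c • v) := by
    rw [TensorProduct.smul_tmul', smul_eq_mul, mul_one, ← TensorProduct.smul_tmul,
      MvPolynomial.smul_monomial, smul_eq_mul, mul_one]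
  rw [← h]
  exact (LinearMap.map_smul _ _ _).symm

open scoped Classical in
/-- The grading of the poset construction is the one for which the classes in `𝒟_{i,l}` have
degree `η l`. -/
theorem isHomogeneousOf_map_posetBasis_iff (η : P →o (Fin n → ℤ))
    (b : ∀ l, Module.Basis (κ l) k (posetSummand k i l))
    (e : M ≃ₗ[MvPolynomial (Fin n) k] posetModule k P n i) {x : M} {γ : Fin n → ℤ} :
    IsHomogeneousOf ((posetBasis n b).map e.symm) (fun s => η s.1) x γ
      ↔ e x ∈ posetGraded k η i γ := by
  constructor
  · intro hx
    let A : AddSubmonoid M :=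
      { carrier := {x | e x ∈ posetGraded k η i γ}
        zero_mem' := by
          have h := (posetGraded k η i γ).zero_mem
          rwa [← map_zero e] at h
        add_mem' := fun {x y} hx hy => by
          have h := (posetGraded k η i γ).add_mem hx hy
          rwa [← map_add e] at h }
    refine mem_of_monomial_smul_mem ((posetBasis n b).map e.symm) A
      fun s a ha c => AddSubgroup.subset_closure ⟨s.1, a, c • b s.1 s.2, hx s a ha, ?_⟩
    rw [map_smul, Module.Basis.map_apply, LinearEquiv.apply_symm_apply, posetBasis_apply]
    exact monomial_smul_lof s.1 a c (b s.1 s.2)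
  · suffices h : ∀ y ∈ posetGraded k η i γ,
        IsHomogeneousOf ((posetBasis n b).map e.symm) (fun s => η s.1) (e.symm y) γ by
      intro hx
      simpa using h _ hx
    intro y hy
    induction hy using AddSubgroup.closure_induction with
    | mem y hy =>
      obtain ⟨l, a, v, rfl, rfl⟩ := hy
      rw [← one_smul k v, ← monomial_smul_lof, map_smul]
      refine IsHomogeneousOf.monomial_smul ?_ a 1
      intro ⟨l', j⟩ a' ha'
      rw [map_posetBasis_repr, LinearEquiv.apply_symm_apply] at ha'
      by_cases h : l = l'
      · subst h
        rw [DirectSum.lof_apply, Module.Basis.baseChange_repr_tmul, MvPolynomial.smul_eq_C_mul,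
          mul_one, MvPolynomial.C_apply] at ha'
        rw [Finset.mem_singleton.1 (MvPolynomial.support_monomial_subset ha'), expZ_zero, zero_add]
      · rw [DirectSum.lof_eq_of, DirectSum.of_eq_of_ne _ _ _ (Ne.symm h), map_zero,
          Finsupp.zero_apply] at ha'
        simp at ha'
    | zero =>
      have h := (homogeneousSubgroup ((posetBasis n b).map e.symm) (fun s => η s.1) γ).zero_mem
      rwa [← map_zero e.symm] at h
    | add y z _ _ hy hz =>
      have h := (homogeneousSubgroup ((posetBasis n b).map e.symm) (fun s => η s.1) γ).add_mem hy hz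
      rwa [← map_add e.symm] at h
    | neg y _ hy =>
      have h := (homogeneousSubgroup ((posetBasis n b).map e.symm) (fun s => η s.1) γ).neg_mem hy
      rwa [← map_neg e.symm] at h

open scoped Classical in
theorem map_posetBasis_mem_posetGraded (η : P →o (Fin n → ℤ))
    (b : ∀ l, Module.Basis (κ l) k (posetSummand k i l))
    (e : M ≃ₗ[MvPolynomial (Fin n) k] posetModule k P n i) (s : Σ l, κ l) :
    e ((posetBasis n b).map e.symm s) ∈ posetGraded k η i (η s.1) :=
  (isHomogeneousOf_map_posetBasis_iff η b e).1
    (IsHomogeneousOf.basis (deg := fun s : Σ l, κ l => η s.1) s)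

end Graded

end PosetBases

/-! ### Recovering the resolution from the poset -/

theorem basis_equiv_repr {R : Type u} {M : Type v} {N : Type w} [CommRing R] [AddCommMonoid M]
    [AddCommMonoid N] [Module R M] [Module R N] {ι κ : Type*} (b : Module.Basis ι R M)
    (b' : Module.Basis κ R N) (e : ι ≃ κ) (x : M) (i : ι) :
    b'.repr (b.equiv b' e x) (e i) = b.repr x i := by
  have h : (b'.reindex e.symm).repr (b.equiv b' e x) = b.repr x :=
    LinearEquiv.apply_symm_apply _ _
  rw [← h, Module.Basis.repr_reindex_apply, Equiv.symm_symm]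

namespace MinimalResolution

variable {k : Type v} [Field k] {n : ℕ} {I : Ideal (MvPolynomial (Fin n) k)}
  (F : MinimalResolution.{u} I)

section

variable {P : Type} [PartialOrder P] [Finite P] {deg : ∀ i, Fin (F.rank i) → P}
  {η : P →o (Fin n → ℤ)}

/-- The basis elements of degree `p` of a minimal free resolution index a basis of the homology of
`Δ_p`. -/
def summandBasis (hC : (F.strand deg).IsAcyclic) (i : ℕ) (p : P) :
    Module.Basis {t : Fin (F.rank i) // deg i t = p} k (posetSummand k i p) :=
  hC.degreeBasis i p

theorem summandBasis_repr_posetMap (hC : (F.strand deg).IsAcyclic) {i : ℕ} {α l : P} (h : l ⋖ α)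
    (t : {t : Fin (F.rank (i + 1)) // deg (i + 1) t = α})
    (hlin : ∀ g, (F.basis i).repr (F.d i (F.basis (i + 1) t.1)) g ≠ 0 → deg i g ⋖ α)
    (g : {t : Fin (F.rank i) // deg i t = l}) :
    (F.summandBasis hC i l).repr (posetMap k i h (F.summandBasis hC (i + 1) α t)) g
      = evalOne k n ((F.basis i).repr (F.d i (F.basis (i + 1) t.1)) g.1) := by
  refine (hC.degreeBasis_repr_posetMap i h t ?_ g).trans ?_
  · exact (Finsupp.mem_supported k _).2 fun g hg =>
      hlin g (F.repr_d_ne_zero (Finsupp.mem_support_iff.1 hg))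
  · exact DFunLike.congr_fun (F.strandD_single i t.1) g.1

/-- A minimal free resolution whose differential, in the given basis, only involves covering
relations of `P` is isomorphic to the poset construction on `P`. -/
theorem exists_equiv_posetModule (hη : ∀ {p q}, η p ≤ η q → p ≤ q)
    (hdeg : ∀ i t, η (deg i t) = F.mdeg i t) (hP : ∀ p, ∃ t, F.mdeg 0 t ≤ η p)
    (hlin : ∀ i t g, (F.basis i).repr (F.d i (F.basis (i + 1) t)) g ≠ 0 →
      deg i g ⋖ deg (i + 1) t) :
    ∃ e : ∀ i, F.F i ≃ₗ[MvPolynomial (Fin n) k] posetModule k P n i,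
      (∀ i x γ, IsHomogeneousOf (F.basis i) (F.mdeg i) x γ ↔ e i x ∈ posetGraded k η i γ) ∧
      ∀ i x, e i (F.d i x) = posetDifferential k η i (e (i + 1) x) := by
  classical
  have hC := F.strand_isAcyclic hη hdeg hP
  let e : ∀ i, F.F i ≃ₗ[MvPolynomial (Fin n) k] posetModule k P n i := fun i =>
    -- The basis of F_i is sorted by degree, and each degree p contributes its basis of the homology
    -- of Δ_p.
    (F.basis i).equiv (posetBasis n (F.summandBasis hC i)) (Equiv.sigmaFiberEquiv (deg i)).symm
  have he : ∀ i t, e i (F.basis i t) = posetBasis n (F.summandBasis hC i) ⟨deg i t, t, rfl⟩ :=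
    fun i t => Module.Basis.equiv_apply _ _ _ _
  refine ⟨e, fun i x γ => ?_, fun i x => ?_⟩
  · rw [← isHomogeneousOf_map_posetBasis_iff η (F.summandBasis hC i) (e i)]
    refine IsHomogeneousOf.iff_of_basis ?_
    rintro ⟨_, t, rfl⟩
    rw [Module.Basis.map_apply, ← he, LinearEquiv.symm_apply_apply, hdeg]
    exact .basis t
  · suffices h : (e i).toLinearMap.comp (F.d i)
        = (posetDifferential k η i).comp (e (i + 1)).toLinearMap from LinearMap.congr_fun h x
    refine (F.basis (i + 1)).ext fun t => ?_
    rw [LinearMap.comp_apply, LinearMap.comp_apply, LinearEquiv.coe_coe, LinearEquiv.coe_coe, he,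
      posetBasis_apply]
    refine (posetBasis n (F.summandBasis hC i)).repr.injective (Finsupp.ext ?_)
    rintro ⟨_, g, rfl⟩
    have h1 : (posetBasis n (F.summandBasis hC i)).repr (e i (F.d i (F.basis (i + 1) t)))
        ⟨deg i g, g, rfl⟩ = (F.basis i).repr (F.d i (F.basis (i + 1) t)) g := by
      exact basis_equiv_repr (F.basis i) (posetBasis n (F.summandBasis hC i))
        (Equiv.sigmaFiberEquiv (deg i)).symm _ g
    rw [h1, posetBasis_repr, posetDifferential_lof]
    -- Along a cover both coefficients are the same scalar times the same monomial; elsewhere both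
    -- vanish, on the side of the resolution by `hlin`.
    split_ifs with h
    · rw [map_smul, Finsupp.smul_apply, Module.Basis.baseChange_repr_tmul,
        F.summandBasis_repr_posetMap hC h ⟨t, rfl⟩ (hlin i t), smul_comm, smul_eq_mul, mul_one,
        hdeg, hdeg]
      exact (F.d_homogeneous i t).repr_eq g
    · rw [map_zero, Finsupp.zero_apply]
      by_contra h'
      exact h (hlin i t g h')

end

/-! ### The two implications -/

/-- The same resolution with another multigraded basis. -/
def changeBasis (b : ∀ i, Module.Basis (Fin (F.rank i)) (MvPolynomial (Fin n) k) (F.F i))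
    (deg : ∀ i, Fin (F.rank i) → Fin n → ℤ)
    (h : ∀ i t, IsHomogeneousOf (F.basis i) (F.mdeg i) (b i t) (deg i t)) :
    MinimalResolution.{u} I where
  F := F.F
  rank := F.rank
  basis := b
  mdeg := deg
  d := F.d
  aug := F.aug
  finite_length := F.finite_length
  d_homogeneous i t := (IsHomogeneousOf.iff_of_basis (h i)).1 ((h (i + 1) t).map (F.d i)
    (F.d_homogeneous i))
  aug_homogeneous t a ha := by
    have := (h 0 t).map F.aug F.aug_isHomogeneousOf () a
    rw [Module.Basis.singleton_repr, add_zero] at this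
    exact this ha
  range_aug := F.range_aug
  exact_zero := F.exact_zero
  exact_succ := F.exact_succ
  minimal := F.minimal

theorem IsBettiLinear.isRecovered (h : F.IsBettiLinear) : F.IsRecovered := by
  obtain ⟨b, deg, hhom, hlin⟩ := h
  -- The bases witnessing linearity become the bases of the resolution, while the poset remains the
  -- one of the original bases.
  let G := F.changeBasis b (fun i t => (deg i t).1) hhom
  obtain ⟨e, he, hd⟩ := G.exists_equiv_posetModule (P := F.bettiPoset) (deg := deg)
    (η := F.bettiIncl) (fun h => h) (fun _ _ => rfl) (by
      rintro ⟨_, i, t, rfl⟩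
      obtain ⟨g, hg⟩ := F.exists_mdeg_zero_le i t
      -- An old generator below the given degree expands in the new basis of F_0, so some new
      -- generator has degree at most its own.
      have hne : (b 0).repr (F.basis 0 g) ≠ 0 := fun h0 =>
        (F.basis 0).ne_zero g ((b 0).repr.map_eq_zero_iff.1 h0)
      obtain ⟨t', ht'⟩ := Finsupp.ne_iff.1 hne
      exact ⟨t', (((IsHomogeneousOf.iff_of_basis (hhom 0)).1
        (.basis g)).le_of_repr_ne_zero ht').trans hg⟩) hlin
  exact ⟨e, fun i x γ => (IsHomogeneousOf.iff_of_basis (hhom i)).trans (he i x γ), hd⟩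

theorem IsRecovered.isBettiLinear (h : F.IsRecovered) : F.IsBettiLinear := by
  classical
  obtain ⟨e, he, hd⟩ := h
  have hfin : ∀ i (l : F.bettiPoset), Module.Finite k (posetSummand k i l) := by
    intro i l
    have : Finite (Fin i ↪o F.bettiPoset) := DFunLike.finite _
    have : Module.Finite k ((Fin i ↪o F.bettiPoset) →₀ k) := inferInstance
    infer_instance
  let w : ∀ i (l : F.bettiPoset), Module.Basis (Fin (Module.finrank k (posetSummand k i l))) k
    (posetSummand k i l) := fun i l => Module.finBasis k (posetSummand k i l)
  let B := fun i => (posetBasis n (w i)).map (e i).symm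
  have heB : ∀ i s, e i (B i s) = posetBasis n (w i) s := fun i s => (e i).apply_symm_apply _
  -- Two bases of F_i have equally many elements, so the transported basis can be indexed as the
  -- definition of linearity demands.
  let σ := fun i => (F.basis i).indexEquiv (B i)
  refine ⟨fun i => (B i).reindex (σ i).symm, fun i t => (σ i t).1, fun i t => ?_, fun i t g => ?_⟩
  · rw [Module.Basis.reindex_apply]
    exact (he i _ _).2 (map_posetBasis_mem_posetGraded F.bettiIncl (w i) (e i) (σ i t))
  · rw [Module.Basis.repr_reindex_apply, Module.Basis.reindex_apply]
    intro h
    by_contra hcov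
    refine h ?_
    change (posetBasis n (w i)).repr (e i (F.d i (B (i + 1) _))) _ = 0
    rw [hd, heB]
    exact posetBasis_repr_posetDifferential F.bettiIncl (w i) (w (i + 1)) _ _ hcov

end MinimalResolution

end BettiLinear

end

theorem mainTheorem1 {k : Type*} [Field k] {n : ℕ} (I : Ideal (MvPolynomial (Fin n) k))
    (hI : BettiLinear.IsMonomialIdeal I) (F : BettiLinear.MinimalResolution I) :
    (F.IsBettiLinear ↔ F.IsRecovered) ∧ (F.IsPure → F.IsRecovered) :=
  ⟨⟨fun h => h.isRecovered, fun h => h.isBettiLinear⟩, fun h => h.isBettiLinear.isRecovered⟩
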